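/- \textbf{Setting.} Let $w_1,\dots,w_m\in\mathbb R[z_1,\dots,z_n]$ be nonzero polynomials, let $d_1,\dots,d_m$ be nonnegative integers, and let $\mathcal V=\{\sum_i w_ir_i : \deg r_i\le 2d_i\}$. Let $\Sigma\subseteq\mathcal V$ be the cone of weighted sums of squares $\sum_i w_i\sigma_i$, where each $\sigma_i$ is a sum of squares of polynomials of degree at most $d_i$. Fix an ordered basis $\mathbf q=(q_1,\dots,q_U)$ of $\mathcal V$ and, for each $i$, an ordered basis $\mathbf p_i$ of the space of polynomials of degree at most $d_i$. Identify polynomials in $\mathcal V$ with their coefficient vectors in $\mathbb R^U$ with respect to $\mathbf q$, so that $\Sigma\subseteq\mathbb R^U$, and let $\Sigma^*=\{\mathbf y\in\mathbb R^U : \mathbf s^{\mathrm T}\mathbf y\ge 0\ \ \forall\,\mathbf s\in\Sigma\}$. Write $K^\circ$ for the interior of $K$. Let $\Lambda_i$ be the linear map from $\mathbb R^U$ to symmetric matrices with $\Lambda_i(\mathbf q)=w_i\mathbf p_i\mathbf p_i^{\mathrm T}$, and put $\Lambda=\Lambda_1\oplus\cdots\oplus\Lambda_m$ (block diagonal). On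 $(\Sigma^*)^\circ$ let $f(\mathbf x)=-\ln\det\Lambda(\mathbf x)$, with gradient $g$ and Hessian $H$, and put $\|\mathbf v\|_{\mathbf x}=(\mathbf v^{\mathrm T}H(\mathbf x)\mathbf v)^{1/2}$ and $\|\mathbf t\|^*_{\mathbf x}=(\mathbf t^{\mathrm T}H(\mathbf x)^{-1}\mathbf t)^{1/2}$. A vector $\mathbf x\in(\Sigma^*)^\circ$ is a \emph{dual certificate} of $\mathbf t\in\Sigma$ if $H(\mathbf x)^{-1}\mathbf t\in\Sigma^*$. Assume that the constant one polynomial belongs to $\mathcal V$ and that its coefficient vector $\mathbf 1$ lies in $\Sigma^\circ$. \textbf{Algorithm.} Let $r\in(0,1/4]$, let $\frac{r^2}{1-2r}<r_N<\frac{r}{1+2r}$, and let the input be any $\mathbf x_0\in(\Sigma^*)^\circ$. Put $\mathbf s:=-g(\mathbf x_0)$, $\mathbf x:=\mathbf x_0$, $c:=0$, and repeat the following loop: \begin{enumerate} \item Set $\mathbf x_+:=2\mathbf x-H(\mathbf x)^{-1}(\mathbf s+c\mathbf 1)$. \item Round every component of $\mathbf x_+$ to a nearest multiple of $1/N$, where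 $N=\Big\lceil\frac{\sqrt U}{2}\,\frac{1+r_N}{r_N-\frac{r^2}{1-2r}}\,\|H(\mathbf x_+)^{1/2}\|\Big\rceil$ (spectral norm); call the result $\mathbf x_N$. \item Let $c_+$ be the largest real solution $t$ of $\|\mathbf x_N-H(\mathbf x_N)^{-1}(\mathbf s+t\mathbf 1)\|_{\mathbf x_N}=\frac r{r+1}$. \item Replace $c$ by a rational number of smallest possible denominator in $[c+\frac12(c_+-c),\,c+\frac23(c_+-c)]$, and replace $\mathbf x$ by $\mathbf x_N$. \item Stop and return $c\mathbf x$ if $\|-g(c\mathbf x)-\mathbf 1\|^*_{c\mathbf x}\le\frac r{r+1}$. \end{enumerate} Ties in steps 2 and 4 may be broken arbitrarily. Call $(\mathbf x,c)$ \emph{reachable} if it equals $(\mathbf x_0,0)$ or is obtained from it by finitely many passes through steps 1--4 (the test in step 5 being ignored). \textbf{Lemma.} For every reachable $(\mathbf x,c)$ one has $\mathbf x\in(\Sigma^*)^\circ$, $\mathbf s+c\mathbf 1\in\Sigma^\circ$, $\mathbf x$ is a dual certificate of $\mathbf s+c\mathbf 1$, and the loop can be executed once more. Moreover: \begin{enumerate}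 \item $\|\mathbf s\|^*_{\mathbf x}\to 0$ as $c\to\infty$: for every $\varepsilon>0$ there is a $C$ such that $\|\mathbf s\|^*_{\mathbf x}<\varepsilon$ for every reachable $(\mathbf x,c)$ with $c\ge C$. Furthermore, along every infinite sequence of iterates $(\mathbf x^{(k)},c^{(k)})_{k\ge0}$ of steps 1--4 started at $(\mathbf x_0,0)$, one has $c^{(k)}\to\infty$ and $\|\mathbf s\|^*_{\mathbf x^{(k)}}\to0$. \item The algorithm terminates: along every such sequence there is a first $K\ge1$ at which the stopping criterion of step 5 holds, and the returned vector $c\mathbf x=c^{(K)}\mathbf x^{(K)}$ lies in $(\Sigma^*)^\circ$ and satisfies $\|-g(c\mathbf x)-\mathbf 1\|^*_{c\mathbf x}\le\frac r{r+1}$. \end{enumerate} -/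

import Mathlib

open Filter Topology
open scoped MatrixOrder Matrix.Norms.L2Operator

noncomputable section

namespace WSOS

/-- The space of real `n`-variate polynomials of degree at most `k`. -/
abbrev polySpace (n k : ℕ) : Submodule ℝ (MvPolynomial (Fin n) ℝ) :=
  MvPolynomial.restrictTotalDegree (Fin n) ℝ k

/-- The space of the polynomials `∑ i, w i * r i` with `deg (r i) ≤ 2 * d i`. -/
def space {n m : ℕ} (w : Fin m → MvPolynomial (Fin n) ℝ) (d : Fin m → ℕ) :
    Submodule ℝ (MvPolynomial (Fin n) ℝ) :=
  ⨆ i, (polySpace n (2 * d i)).map (LinearMap.mulLeft ℝ (w i))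

/-- `σ` is a sum of squares of polynomials of degree at most `k`. -/
def IsSOS {n : ℕ} (k : ℕ) (σ : MvPolynomial (Fin n) ℝ) : Prop :=
  ∃ (l : ℕ) (h : Fin l → MvPolynomial (Fin n) ℝ),
    (∀ j, h j ∈ polySpace n k) ∧ σ = ∑ j, h j ^ 2

/-- `t` is a weighted sum of squares `∑ i, w i * σ i`, each `σ i` being a sum of squares of
polynomials of degree at most `d i`. -/
def IsWSOS {n m : ℕ} (w : Fin m → MvPolynomial (Fin n) ℝ) (d : Fin m → ℕ)
    (t : MvPolynomial (Fin n) ℝ) : Prop :=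
  ∃ σ : Fin m → MvPolynomial (Fin n) ℝ, (∀ i, IsSOS (d i) (σ i)) ∧ t = ∑ i, w i * σ i

theorem mul_mul_mem_space {n m : ℕ} (w : Fin m → MvPolynomial (Fin n) ℝ) (d : Fin m → ℕ)
    (i : Fin m) {a b : MvPolynomial (Fin n) ℝ} (ha : a ∈ polySpace n (d i))
    (hb : b ∈ polySpace n (d i)) : w i * (a * b) ∈ space w d := by
  refine Submodule.mem_iSup_of_mem i ⟨a * b, ?_, rfl⟩
  have ha' := (MvPolynomial.mem_restrictTotalDegree (Fin n) (d i) a).1 ha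
  have hb' := (MvPolynomial.mem_restrictTotalDegree (Fin n) (d i) b).1 hb
  refine (MvPolynomial.mem_restrictTotalDegree (Fin n) (2 * d i) (a * b)).2 ?_
  have := MvPolynomial.totalDegree_mul a b
  omega

/-- The data fixing a cone of weighted sums of squares and its representation in coordinates:
nonzero weights `w i`, degrees `d i`, an ordered basis `q` of the ambient space of polynomials and
ordered bases `p i` of the spaces of polynomials of degree at most `d i`. -/
structure Setup (n m : ℕ) where
  w : Fin m → MvPolynomial (Fin n) ℝ
  w_ne_zero : ∀ i, w i ≠ 0
  d : Fin m → ℕ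
  U : ℕ
  q : Module.Basis (Fin U) ℝ (space w d)
  L : Fin m → ℕ
  p : (i : Fin m) → Module.Basis (Fin (L i)) ℝ (polySpace n (d i))

namespace Setup

variable {n m : ℕ} (S : Setup n m)

/-- Coefficient vectors with respect to the basis `q`. -/
abbrev Vec : Type := Fin S.U → ℝ

/-- The polynomial with coefficient vector `s`. -/
def toPoly (s : S.Vec) : MvPolynomial (Fin n) ℝ :=
  ∑ u, s u • (S.q u : MvPolynomial (Fin n) ℝ)

/-- The cone `Σ` of coefficient vectors of weighted sums of squares. -/
def cone : Set S.Vec := {s | IsWSOS S.w S.d (S.toPoly s)}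

/-- The dual cone `Σ*`. -/
def dualCone : Set S.Vec := {y | ∀ s ∈ S.cone, 0 ≤ s ⬝ᵥ y}

/-- The linear map `Λ i`, determined by `Λ i (q) = w i • p i (p i)ᵀ`: the `(j, k)` entry applies
to `x` the linear combination expressing `w i * p i j * p i k` in the basis `q`. -/
def lam (i : Fin m) (x : S.Vec) : Matrix (Fin (S.L i)) (Fin (S.L i)) ℝ :=
  Matrix.of fun j k =>
    ∑ u, S.q.repr ⟨S.w i * ((S.p i j : MvPolynomial (Fin n) ℝ) * S.p i k),
      mul_mul_mem_space S.w S.d i (S.p i j).2 (S.p i k).2⟩ u * x u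

/-- `Λ = Λ 1 ⊕ ⋯ ⊕ Λ m`, as a block diagonal matrix. -/
def Lam (x : S.Vec) : Matrix (Σ i, Fin (S.L i)) (Σ i, Fin (S.L i)) ℝ :=
  Matrix.blockDiagonal' fun i => S.lam i x

/-- The barrier function `f = - ln det Λ` (meaningful on the interior of `Σ*`). -/
def barrier (x : S.Vec) : ℝ := -Real.log (S.Lam x).det

/-- The gradient of the barrier function. -/
def grad (x : S.Vec) : S.Vec := fun u => fderiv ℝ S.barrier x (Pi.single u 1)

/-- The Hessian matrix of the barrier function. -/
def hess (x : S.Vec) : Matrix (Fin S.U) (Fin S.U) ℝ :=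
  Matrix.of fun u v => fderiv ℝ (fun z => S.grad z v) x (Pi.single u 1)

/-- The local norm `‖v‖_x`. -/
def localNorm (x v : S.Vec) : ℝ := √(v ⬝ᵥ (S.hess x).mulVec v)

/-- The dual local norm `‖t‖*_x`. -/
def dualNorm (x t : S.Vec) : ℝ := √(t ⬝ᵥ ((S.hess x)⁻¹).mulVec t)

/-- `x` is a dual certificate of `s`. -/
def IsDualCertificate (x s : S.Vec) : Prop :=
  s ∈ S.cone ∧ x ∈ interior S.dualCone ∧ ((S.hess x)⁻¹).mulVec s ∈ S.dualCone

/-- The values of the two variables of the algorithm between two passes through its loop. -/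
structure State where
  x : S.Vec
  c : ℚ

/-- The denominator `N = ⌈(√U / 2) * ((1 + r_N) / (r_N - r ^ 2 / (1 - 2 r))) * ‖H(x₊)^(1/2)‖⌉`
(with the spectral norm). -/
def roundDenom (r rN : ℝ) (xp : S.Vec) : ℕ :=
  ⌈√(S.U : ℝ) / 2 * ((1 + rN) / (rN - r ^ 2 / (1 - 2 * r))) * ‖CFC.sqrt (S.hess xp)‖⌉₊

/-- `xN` arises from `xp` by rounding every component to a nearest multiple of `1 / N`. -/
def IsRounding (N : ℕ) (xp xN : S.Vec) : Prop :=
  ∀ u, (∃ z : ℤ, xN u = z / N) ∧ |xN u - xp u| ≤ 1 / (2 * N)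

/-- `c'` is a rational number in `[a, b]` with the smallest possible denominator. -/
def _root_.WSOS.IsSimplestRat (a b : ℝ) (c' : ℚ) : Prop :=
  (c' : ℝ) ∈ Set.Icc a b ∧ ∀ k : ℚ, (k : ℝ) ∈ Set.Icc a b → c'.den ≤ k.den

/-- One pass through the loop of the initialization algorithm, for the polynomial `s` and the
coefficient vector `e` of the constant one polynomial. It is a relation, since ties in the two
rounding steps may be broken in any way. -/
def LoopStep (e s : S.Vec) (r rN : ℝ) (a b : S.State) : Prop :=
  ∃ (xp xN : S.Vec) (cp : ℝ),
    xp = (2 : ℝ) • a.x - ((S.hess a.x)⁻¹).mulVec (s + (a.c : ℝ) • e) ∧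
    S.IsRounding (S.roundDenom r rN xp) xp xN ∧
    IsGreatest {t : ℝ |
      S.localNorm xN (xN - ((S.hess xN)⁻¹).mulVec (s + t • e)) = r / (r + 1)} cp ∧
    IsSimplestRat (a.c + 1 / 2 * (cp - a.c)) (a.c + 2 / 3 * (cp - a.c)) b.c ∧
    b.x = xN

/-- The values of the variables before the first pass through the loop. -/
def start (x₀ : S.Vec) : S.State := ⟨x₀, 0⟩

/-- `σ` lists the successive values of the variables when the loop, started at `x₀` and with
`s = -g(x₀)`, is repeated without ever testing the stopping criterion. -/
def IsRun (e : S.Vec) (r rN : ℝ) (x₀ : S.Vec) (σ : ℕ → S.State) : Prop :=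
  σ 0 = S.start x₀ ∧ ∀ k, S.LoopStep e (-S.grad x₀) r rN (σ k) (σ (k + 1))

/-- `a` is reached from the start after finitely many passes through the loop. -/
def Reachable (e : S.Vec) (r rN : ℝ) (x₀ : S.Vec) (a : S.State) : Prop :=
  Relation.ReflTransGen (S.LoopStep e (-S.grad x₀) r rN) (S.start x₀) a

/-- The stopping criterion `‖-g(c x) - 1‖*_{c x} ≤ r / (r + 1)`, tested after every pass. -/
def Stops (e : S.Vec) (r : ℝ) (a : S.State) : Prop :=
  S.dualNorm ((a.c : ℝ) • a.x) (-S.grad ((a.c : ℝ) • a.x) - e) ≤ r / (r + 1)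

end Setup

end WSOS

end

/-! Write s = -g(x₀), e for the vector of the constant one, ρ = r/(r+1), and ν for the size of Λ.
The quantity that controls everything is the decrement ‖-g(x) - t‖*_x for t = s + c e, and the loop
keeps it at most ρ < 1. Since H(x)x = -g(x), the decrement equals ‖x - H(x)⁻¹t‖_x; below 1 it puts
H(x)⁻¹t in the Dikin ellipsoid of x, hence in the interior of Σ*, and then t itself is interior to Σ
(`mem_interior_cone`).

A Newton step squares the decrement (`dualNorm_newton_le`), and rounding with the prescribed N
leaves it at most `roundedDecrement`, which is strictly below ρ (`newton_round`,
`roundedDecrement_lt`). This gap lets c grow, and moving c at most 2/3 of the way to c₊ keeps a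
third of the gap (`loopStep_spec`). The estimates rest on one principle, `dualNorm_sq_le`: if l(v) =
tr(M Λ(v)), then ‖l‖*_y is at most the Frobenius norm of M scaled by Λ(y).

A decrement at most ρ also gives ⟨s + c e, x⟩ ≤ ν + √ν. Hence ⟨s, x⟩ is bounded, so ‖e‖*_x is
bounded and c increases by a fixed amount in each pass (`exists_increment`). As e - κs ∈ Σ for some
κ > 0, moreover ‖s‖*_x ≤ ⟨s, x⟩ = O(1/c). By homogeneity the stopping quantity is ‖-g(x) - c e‖*_x,
at most the decrement plus ‖s‖*_x; once the latter is below a third of the gap, the test succeeds.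
-/

noncomputable section

namespace WSOS

open Matrix

/-! ### Trace inequalities and norms of quadratic forms. -/

section Matrices

variable {ι : Type*} [Fintype ι]

theorem trace_mul_sq_le (A B : Matrix ι ι ℝ) :
    (A * B).trace ^ 2 ≤ (A * Aᵀ).trace * (Bᵀ * B).trace := by
  have h := Finset.sum_mul_sq_le_sq_mul_sq (Finset.univ : Finset (ι × ι))
    (fun p => A p.1 p.2) (fun p => B p.2 p.1)
  simp only [Fintype.sum_prod_type] at h
  have e1 : (A * B).trace = ∑ i, ∑ j, A i j * B j i := by simp [Matrix.trace, Matrix.mul_apply]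
  have e2 : (A * Aᵀ).trace = ∑ i, ∑ j, A i j ^ 2 := by
    simp [Matrix.trace, Matrix.mul_apply, sq]
  have e3 : (Bᵀ * B).trace = ∑ i, ∑ j, B j i ^ 2 := by
    simp [Matrix.trace, Matrix.mul_apply, sq]
  rw [e1, e2, e3]; exact h

/-- The norm of `v` with respect to a positive semidefinite form. -/
def formNorm (Q : Matrix ι ι ℝ) (v : ι → ℝ) : ℝ := √(v ⬝ᵥ Q *ᵥ v)

theorem formNorm_nonneg (Q : Matrix ι ι ℝ) (v : ι → ℝ) : 0 ≤ formNorm Q v := Real.sqrt_nonneg _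

theorem formNorm_sq {Q : Matrix ι ι ℝ} (hQ : Q.PosSemidef) (v : ι → ℝ) :
    formNorm Q v ^ 2 = v ⬝ᵥ Q *ᵥ v :=
  Real.sq_sqrt (by simpa using hQ.dotProduct_mulVec_nonneg v)

theorem formNorm_smul {Q : Matrix ι ι ℝ} (c : ℝ) (v : ι → ℝ) :
    formNorm Q (c • v) = |c| * formNorm Q v := by
  rw [formNorm, formNorm, Matrix.mulVec_smul, smul_dotProduct, dotProduct_smul, smul_eq_mul,
    smul_eq_mul, ← mul_assoc, Real.sqrt_mul (mul_self_nonneg c), Real.sqrt_mul_self_eq_abs]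

theorem formNorm_neg {Q : Matrix ι ι ℝ} (v : ι → ℝ) :
    formNorm Q (-v) = formNorm Q v := by
  simpa using formNorm_smul (Q := Q) (-1) v

variable [DecidableEq ι]

theorem exists_symm_sq_eq {X : Matrix ι ι ℝ} (hX : X.PosSemidef) :
    ∃ C : Matrix ι ι ℝ, Cᵀ = C ∧ C * C = X := by
  refine ⟨CFC.sqrt X, ?_, CFC.sqrt_mul_sqrt_self X hX.nonneg⟩
  have h : (CFC.sqrt X)ᴴ = CFC.sqrt X := (CFC.sqrt_nonneg X).posSemidef.isHermitian
  simpa using h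

/-- The Cauchy-Schwarz inequality for the local inner product at `X` and its dual. -/
theorem trace_mul_sq_le_of_posDef {X M D : Matrix ι ι ℝ} (hX : X.PosDef) (hM : Mᵀ = M)
    (hD : Dᵀ = D) :
    (M * D).trace ^ 2 ≤ (M * X * M * X).trace * (X⁻¹ * D * X⁻¹ * D).trace := by
  obtain ⟨C, hC, rfl⟩ := exists_symm_sq_eq hX.posSemidef
  have hdet : IsUnit C.det := by
    have := (Matrix.isUnit_iff_isUnit_det _).1 hX.isUnit
    rw [Matrix.det_mul] at this
    exact isUnit_of_mul_isUnit_left this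
  have hCi : (C⁻¹)ᵀ = C⁻¹ := by rw [Matrix.transpose_nonsing_inv, hC]
  -- With X = C², the congruences by C and C⁻¹ turn both local norms into Frobenius norms and leave
  -- tr(MD) unchanged.
  have h := trace_mul_sq_le (C * M * C) (C⁻¹ * D * C⁻¹)
  have e1 : (C * M * C) * (C⁻¹ * D * C⁻¹) = C * (M * D) * C⁻¹ := by
    simp only [Matrix.mul_assoc, Matrix.mul_nonsing_inv_cancel_left _ _ hdet]
  have e2 : (C * (M * D) * C⁻¹).trace = (M * D).trace := by
    rw [Matrix.trace_mul_comm, Matrix.nonsing_inv_mul_cancel_left _ _ hdet]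
  have e3 : (C * M * C * (C * M * C)ᵀ).trace = (M * (C * C) * M * (C * C)).trace := by
    simp only [Matrix.transpose_mul, hC, hM]
    rw [Matrix.mul_assoc, Matrix.mul_assoc, Matrix.trace_mul_comm]
    simp only [Matrix.mul_assoc]
  have e4 : ((C⁻¹ * D * C⁻¹)ᵀ * (C⁻¹ * D * C⁻¹)).trace
      = ((C * C)⁻¹ * D * (C * C)⁻¹ * D).trace := by
    simp only [Matrix.transpose_mul, hCi, hD, Matrix.mul_inv_rev]
    rw [← Matrix.mul_assoc, Matrix.trace_mul_comm]
    simp only [Matrix.mul_assoc]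
  rw [e1, e2, e3, e4] at h
  exact h

/-- With P = C², the entries of P are inner products of columns of C, so P_ij² ≤ P_ii P_jj; sum over
i and j. -/
theorem trace_mul_self_le {P : Matrix ι ι ℝ} (hP : P.PosSemidef) :
    (P * P).trace ≤ P.trace ^ 2 := by
  obtain ⟨C, hC, rfl⟩ := exists_symm_sq_eq hP
  have e : ∀ i j, (C * C) i j = ∑ k, C k i * C k j := fun i j => by
    nth_rewrite 1 [← hC]; simp [Matrix.mul_apply]
  have e1 : (C * C * (C * C)).trace = ∑ i, ∑ j, (∑ k, C k i * C k j) ^ 2 := by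
    rw [Matrix.trace]
    refine Finset.sum_congr rfl fun i _ => ?_
    rw [Matrix.diag_apply, Matrix.mul_apply]
    refine Finset.sum_congr rfl fun j _ => ?_
    rw [e, e, sq]
    congr 1
    exact Finset.sum_congr rfl fun k _ => mul_comm _ _
  have e2 : (C * C).trace = ∑ i, ∑ k, C k i ^ 2 := by
    simp only [Matrix.trace, Matrix.diag_apply, e, sq]
  rw [e1, e2, sq, Finset.sum_mul_sum]
  exact Finset.sum_le_sum fun i _ => Finset.sum_le_sum fun j _ =>
    Finset.sum_mul_sq_le_sq_mul_sq _ _ _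

theorem trace_mul_nonneg {P Q : Matrix ι ι ℝ} (hP : P.PosSemidef) (hQ : Q.PosSemidef) :
    0 ≤ (P * Q).trace := by
  obtain ⟨C, hC, rfl⟩ := exists_symm_sq_eq hP
  have h := (hQ.mul_mul_conjTranspose_same C).trace_nonneg
  rwa [Matrix.conjTranspose_eq_transpose_of_trivial, hC, Matrix.mul_assoc, Matrix.trace_mul_comm,
    Matrix.mul_assoc, Matrix.trace_mul_comm] at h

theorem trace_mul_mul_mul_le_sq {M X : Matrix ι ι ℝ} (hM : M.PosSemidef) (hX : X.PosSemidef) :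
    (M * X * M * X).trace ≤ (M * X).trace ^ 2 := by
  obtain ⟨C, hC, rfl⟩ := exists_symm_sq_eq hX
  have h := trace_mul_self_le (hM.mul_mul_conjTranspose_same C)
  rw [Matrix.conjTranspose_eq_transpose_of_trivial, hC] at h
  have e1 : (C * M * C).trace = (M * (C * C)).trace := by
    rw [Matrix.mul_assoc, Matrix.trace_mul_comm, Matrix.mul_assoc]
  have e2 : (C * M * C * (C * M * C)).trace = (M * (C * C) * M * (C * C)).trace := by
    rw [Matrix.mul_assoc, Matrix.mul_assoc, Matrix.trace_mul_comm]
    simp only [Matrix.mul_assoc]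
  rwa [e1, e2] at h

/-- The difference of the two sides is tr((P - W) M (P + W) M), the cross terms cancelling by
cyclicity of the trace. -/
theorem trace_mul_mul_mul_mono {P W M : Matrix ι ι ℝ} (h₁ : (P - W).PosSemidef)
    (h₂ : (P + W).PosSemidef) (hM : Mᵀ = M) :
    (M * W * M * W).trace ≤ (M * P * M * P).trace := by
  have h := trace_mul_nonneg h₁ (h₂.mul_mul_conjTranspose_same M)
  rw [Matrix.conjTranspose_eq_transpose_of_trivial, hM] at h
  have e : ((P - W) * (M * (P + W) * M)).trace
      = (M * P * M * P).trace - (M * W * M * W).trace := by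
    have e1 : ∀ A B : Matrix ι ι ℝ, (A * (M * B * M)).trace = (M * B * M * A).trace :=
      fun A B => Matrix.trace_mul_comm _ _
    have e2 : (M * W * M * P).trace = (M * P * M * W).trace := by
      rw [Matrix.mul_assoc (M * W), Matrix.trace_mul_comm, ← Matrix.mul_assoc]
    rw [e1]
    simp only [Matrix.mul_add, Matrix.add_mul, Matrix.mul_sub, Matrix.trace_add,
      Matrix.trace_sub, e2]
    ring
  linarith

/-- Local Cauchy-Schwarz with the rank-one matrix M = vvᵀ. -/
theorem dotProduct_mulVec_sq_le {X D : Matrix ι ι ℝ} (hX : X.PosDef) (hD : Dᵀ = D) (v : ι → ℝ) :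
    (v ⬝ᵥ D *ᵥ v) ^ 2 ≤ (v ⬝ᵥ X *ᵥ v) ^ 2 * (X⁻¹ * D * X⁻¹ * D).trace := by
  have h := trace_mul_sq_le_of_posDef (M := vecMulVec v v) hX (by simp [transpose_vecMulVec]) hD
  have e : ∀ A : Matrix ι ι ℝ, (vecMulVec v v * A).trace = v ⬝ᵥ A *ᵥ v := fun A => by
    rw [Matrix.vecMulVec_mul, Matrix.trace_vecMulVec, Matrix.dotProduct_mulVec, dotProduct_comm]
  have e2 : (vecMulVec v v * X * vecMulVec v v * X).trace = (v ⬝ᵥ X *ᵥ v) ^ 2 := by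
    rw [Matrix.mul_assoc, Matrix.mul_assoc, e, ← Matrix.mulVec_mulVec, ← Matrix.mulVec_mulVec,
      Matrix.vecMulVec_mulVec, Matrix.mulVec_smul]
    simp [sq]
  rwa [e, e2] at h

/-- A symmetric matrix of local norm at most `δ` at `X` lies between `-δ • X` and `δ • X`. -/
theorem posSemidef_smul_add {X D : Matrix ι ι ℝ} (hX : X.PosDef) (hD : Dᵀ = D) {δ : ℝ}
    (hδ : 0 ≤ δ) (h : (X⁻¹ * D * X⁻¹ * D).trace ≤ δ ^ 2) : (δ • X + D).PosSemidef := by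
  refine .of_dotProduct_mulVec_nonneg ?_ fun v => ?_
  · have := hX.isHermitian
    rw [Matrix.IsHermitian, Matrix.conjTranspose_eq_transpose_of_trivial] at *
    simp [this, hD]
  · have h1 := dotProduct_mulVec_sq_le hX hD v
    have h2 : 0 ≤ v ⬝ᵥ X *ᵥ v := by simpa using hX.posSemidef.dotProduct_mulVec_nonneg v
    have h3 : (v ⬝ᵥ D *ᵥ v) ^ 2 ≤ (δ * (v ⬝ᵥ X *ᵥ v)) ^ 2 := by
      rw [mul_pow, mul_comm (δ ^ 2)]
      exact h1.trans (mul_le_mul_of_nonneg_left h (sq_nonneg _))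
    have h4 := abs_le_of_sq_le_sq' h3 (by positivity)
    simp only [star_trivial, Matrix.add_mulVec, Matrix.smul_mulVec, dotProduct_add,
      dotProduct_smul, smul_eq_mul]
    linarith [h4.1]

theorem posDef_add {X D : Matrix ι ι ℝ} (hX : X.PosDef) (hD : Dᵀ = D)
    (h : (X⁻¹ * D * X⁻¹ * D).trace < 1) : (X + D).PosDef := by
  set δ := √((X⁻¹ * D * X⁻¹ * D).trace)
  have hδ : δ < 1 := by rw [Real.sqrt_lt' one_pos]; simpa using h
  have h1 : (δ • X + D).PosSemidef := by
    refine posSemidef_smul_add hX hD (Real.sqrt_nonneg _) ?_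
    -- If the trace were negative, the square root would be 0 by convention and the bound would
    -- still hold, so its sign need not be settled.
    by_cases h0 : 0 ≤ (X⁻¹ * D * X⁻¹ * D).trace
    · rw [Real.sq_sqrt h0]
    · exact (not_le.1 h0).le.trans (sq_nonneg _)
  have h2 : ((1 - δ) • X).PosDef := hX.smul (by linarith)
  convert h2.add_posSemidef h1 using 1
  module

theorem exists_formNorm_eq {Q : Matrix ι ι ℝ} (hQ : Q.PosSemidef) :
    ∃ C : Matrix ι ι ℝ, Cᵀ = C ∧ C * C = Q ∧ ∀ v, formNorm Q v = ‖WithLp.toLp 2 (C *ᵥ v)‖ := by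
  obtain ⟨C, hC, rfl⟩ := exists_symm_sq_eq hQ
  refine ⟨C, hC, rfl, fun v => ?_⟩
  rw [formNorm, EuclideanSpace.norm_eq, ← Matrix.mulVec_mulVec, Matrix.dotProduct_mulVec]
  nth_rewrite 1 [← hC]
  rw [Matrix.vecMul_transpose]
  simp [dotProduct, sq]

theorem formNorm_add_le {Q : Matrix ι ι ℝ} (hQ : Q.PosSemidef) (v w : ι → ℝ) :
    formNorm Q (v + w) ≤ formNorm Q v + formNorm Q w := by
  obtain ⟨C, -, -, hC⟩ := exists_formNorm_eq hQ
  simp only [hC, Matrix.mulVec_add, WithLp.toLp_add]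
  exact norm_add_le _ _

theorem mulVec_inv_mulVec {Q : Matrix ι ι ℝ} (hQ : Q.PosDef) (t : ι → ℝ) :
    Q *ᵥ (Q⁻¹ *ᵥ t) = t := by
  rw [Matrix.mulVec_mulVec, Matrix.mul_nonsing_inv _ ((Matrix.isUnit_iff_isUnit_det _).1 hQ.isUnit),
    Matrix.one_mulVec]

theorem inv_mulVec_mulVec {Q : Matrix ι ι ℝ} (hQ : Q.PosDef) (t : ι → ℝ) :
    Q⁻¹ *ᵥ (Q *ᵥ t) = t := by
  rw [Matrix.mulVec_mulVec, Matrix.nonsing_inv_mul _ ((Matrix.isUnit_iff_isUnit_det _).1 hQ.isUnit),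
    Matrix.one_mulVec]

theorem formNorm_inv_mulVec {Q : Matrix ι ι ℝ} (hQ : Q.PosDef) (t : ι → ℝ) :
    formNorm Q (Q⁻¹ *ᵥ t) = formNorm Q⁻¹ t := by
  rw [formNorm, formNorm, mulVec_inv_mulVec hQ, dotProduct_comm]

/-- Euclidean Cauchy-Schwarz after applying a square root of Q to Q⁻¹t and to v. -/
theorem dotProduct_le_formNorm {Q : Matrix ι ι ℝ} (hQ : Q.PosDef) (t v : ι → ℝ) :
    t ⬝ᵥ v ≤ formNorm Q⁻¹ t * formNorm Q v := by
  obtain ⟨C, hC, hQC, hn⟩ := exists_formNorm_eq hQ.posSemidef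
  rw [← formNorm_inv_mulVec hQ, hn, hn]
  have h := real_inner_le_norm (WithLp.toLp 2 (C *ᵥ (Q⁻¹ *ᵥ t))) (WithLp.toLp 2 (C *ᵥ v))
  rw [EuclideanSpace.inner_toLp_toLp, star_trivial, dotProduct_comm, Matrix.dotProduct_mulVec,
    ← Matrix.mulVec_transpose, hC, Matrix.mulVec_mulVec, hQC, mulVec_inv_mulVec hQ] at h
  exact h

end Matrices

/-! ### The cone Σ and the description of Σ* and its interior through Λ. -/

theorem IsSOS.zero {n k : ℕ} : IsSOS k (0 : MvPolynomial (Fin n) ℝ) :=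
  ⟨0, fun _ => 0, fun _ => Submodule.zero_mem _, by simp⟩

theorem IsSOS.add {n k : ℕ} {σ τ : MvPolynomial (Fin n) ℝ} (hσ : IsSOS k σ) (hτ : IsSOS k τ) :
    IsSOS k (σ + τ) := by
  obtain ⟨l₁, h₁, m₁, rfl⟩ := hσ
  obtain ⟨l₂, h₂, m₂, rfl⟩ := hτ
  refine ⟨l₁ + l₂, Fin.append h₁ h₂, fun j => ?_, by simp [Fin.sum_univ_add]⟩
  refine Fin.addCases (fun i => ?_) (fun i => ?_) j
  · rw [Fin.append_left]; exact m₁ i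
  · rw [Fin.append_right]; exact m₂ i

theorem IsSOS.sq {n k : ℕ} {h : MvPolynomial (Fin n) ℝ} (hh : h ∈ polySpace n k) :
    IsSOS k (h * h) :=
  ⟨1, fun _ => h, fun _ => hh, by simp [_root_.sq]⟩

namespace Setup

variable {n m : ℕ} (S : Setup n m)

theorem toPoly_eq (s : S.Vec) : S.toPoly s = (S.q.equivFun.symm s : space S.w S.d) := by
  simp [toPoly, Module.Basis.equivFun_symm_apply]

theorem toPoly_equivFun (a : space S.w S.d) : S.toPoly (S.q.equivFun a) = a := by
  rw [toPoly_eq, LinearEquiv.symm_apply_apply]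

theorem toPoly_injective : Function.Injective S.toPoly := fun s t h => by
  rw [toPoly_eq, toPoly_eq] at h
  exact S.q.equivFun.symm.injective (Subtype.ext h)

theorem toPoly_add (s t : S.Vec) : S.toPoly (s + t) = S.toPoly s + S.toPoly t := by
  rw [toPoly_eq, toPoly_eq, toPoly_eq, map_add]; rfl

theorem zero_mem_cone : (0 : S.Vec) ∈ S.cone :=
  ⟨fun _ => 0, fun _ => .zero, by simp [toPoly]⟩

theorem add_mem_cone {s t : S.Vec} (hs : s ∈ S.cone) (ht : t ∈ S.cone) : s + t ∈ S.cone := by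
  obtain ⟨σ, hσ, e₁⟩ := hs
  obtain ⟨τ, hτ, e₂⟩ := ht
  refine ⟨fun i => σ i + τ i, fun i => (hσ i).add (hτ i), ?_⟩
  rw [toPoly_add, e₁, e₂, ← Finset.sum_add_distrib]
  exact Finset.sum_congr rfl fun i _ => (mul_add _ _ _).symm

theorem sum_mem_cone {κ : Type*} (T : Finset κ) (s : κ → S.Vec) (h : ∀ k ∈ T, s k ∈ S.cone) :
    ∑ k ∈ T, s k ∈ S.cone :=
  Finset.sum_induction s (· ∈ S.cone) (fun _ _ => S.add_mem_cone) S.zero_mem_cone h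

/-- The product `w i * (a * b)` as a bilinear map into the ambient space. -/
def weightedMul (i : Fin m) :
    polySpace n (S.d i) →ₗ[ℝ] polySpace n (S.d i) →ₗ[ℝ] space S.w S.d :=
  LinearMap.mk₂ ℝ
    (fun a b => ⟨S.w i * (a.1 * b.1), mul_mul_mem_space S.w S.d i a.2 b.2⟩)
    (fun a b c => Subtype.ext (by simp; ring)) (fun c a b => Subtype.ext (by simp))
    (fun a b c => Subtype.ext (by simp; ring)) (fun c a b => Subtype.ext (by simp))

/-- The coefficient vector of `w i * (∑ j, b j * p i j) ^ 2`. -/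
def squareVec (i : Fin m) (b : Fin (S.L i) → ℝ) : S.Vec :=
  S.q.equivFun (S.weightedMul i ((S.p i).equivFun.symm b) ((S.p i).equivFun.symm b))

theorem squareVec_equivFun (i : Fin m) (h : polySpace n (S.d i)) :
    S.squareVec i ((S.p i).equivFun h) = S.q.equivFun (S.weightedMul i h h) := by
  rw [squareVec, LinearEquiv.symm_apply_apply]

theorem squareVec_mem_cone (i : Fin m) (b : Fin (S.L i) → ℝ) : S.squareVec i b ∈ S.cone := by
  set h := (S.p i).equivFun.symm b with hh
  refine ⟨fun k => if k = i then h.1 * h.1 else 0, fun k => ?_, ?_⟩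
  · dsimp only
    split_ifs with hk
    · subst hk; exact IsSOS.sq h.2
    · exact .zero
  · rw [squareVec, toPoly_equivFun]
    simp [weightedMul, ← hh]

/-- The polynomial ring is a domain and the weights are nonzero. This is what makes Λ definite, and
not just semidefinite, on the interior of Σ*. -/
theorem squareVec_ne_zero (i : Fin m) {b : Fin (S.L i) → ℝ} (hb : b ≠ 0) :
    S.squareVec i b ≠ 0 := by
  intro h
  rw [squareVec, LinearEquiv.map_eq_zero_iff] at h
  have h' := congrArg Subtype.val h
  simp only [weightedMul, LinearMap.mk₂_apply, ZeroMemClass.coe_zero, mul_eq_zero, S.w_ne_zero i,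
    false_or, or_self, ZeroMemClass.coe_eq_zero] at h'
  exact hb ((LinearEquiv.map_eq_zero_iff _).1 h')

theorem lam_transpose (i : Fin m) (x : S.Vec) : (S.lam i x)ᵀ = S.lam i x := by
  ext j k
  simp only [lam, Matrix.transpose_apply, Matrix.of_apply,
    mul_comm (S.p i k : MvPolynomial (Fin n) ℝ)]

theorem squareVec_dotProduct (i : Fin m) (b : Fin (S.L i) → ℝ) (x : S.Vec) :
    S.squareVec i b ⬝ᵥ x = b ⬝ᵥ S.lam i x *ᵥ b := by
  have e : ∀ j k, S.lam i x j k = S.q.equivFun (S.weightedMul i (S.p i j) (S.p i k)) ⬝ᵥ x :=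
    fun j k => rfl
  have e' : ∀ a : Fin (S.L i) → S.Vec, ∀ c : Fin (S.L i) → ℝ,
      (∑ j, c j • a j) ⬝ᵥ x = ∑ j, c j * (a j ⬝ᵥ x) := fun a c => by
    simp only [sum_dotProduct, smul_dotProduct, smul_eq_mul]
  rw [squareVec, Module.Basis.equivFun_symm_apply]
  simp only [map_sum, map_smul, LinearMap.sum_apply, LinearMap.smul_apply, e']
  rw [dotProduct]
  refine Finset.sum_congr rfl fun k _ => ?_
  rw [Matrix.mulVec, dotProduct]
  congr 1
  refine Finset.sum_congr rfl fun j _ => ?_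
  rw [← lam_transpose, Matrix.transpose_apply, e, mul_comm]

theorem dotProduct_Lam_mulVec (v : (Σ i, Fin (S.L i)) → ℝ) (x : S.Vec) :
    v ⬝ᵥ S.Lam x *ᵥ v = (∑ i, S.squareVec i fun j => v ⟨i, j⟩) ⬝ᵥ x := by
  rw [sum_dotProduct]
  simp only [squareVec_dotProduct]
  simp only [dotProduct, Matrix.mulVec, Fintype.sum_sigma, Lam]
  refine Finset.sum_congr rfl fun i _ => Finset.sum_congr rfl fun j _ => ?_
  congr 1
  rw [Finset.sum_eq_single i]
  · simp
  · intro k _ hk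
    exact Finset.sum_eq_zero fun l _ => by
      rw [Matrix.blockDiagonal'_apply_ne _ _ _ (Ne.symm hk), zero_mul]
  · simp

theorem Lam_transpose (x : S.Vec) : (S.Lam x)ᵀ = S.Lam x := by
  simp only [Lam, Matrix.blockDiagonal'_transpose, lam_transpose]

/-- `Λ` as a linear map. -/
def LamL : S.Vec →ₗ[ℝ] Matrix (Σ i, Fin (S.L i)) (Σ i, Fin (S.L i)) ℝ where
  toFun := S.Lam
  map_add' x y := by
    rw [Lam, Lam, Lam, ← Matrix.blockDiagonal'_add]
    congr 1; ext i j k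
    simp [lam, mul_add, Finset.sum_add_distrib]
  map_smul' c x := by
    rw [Lam, Lam, RingHom.id_apply, ← Matrix.blockDiagonal'_smul]
    congr 1; ext i j k
    simp [lam, Finset.mul_sum, mul_left_comm]

theorem Lam_add (x y : S.Vec) : S.Lam (x + y) = S.Lam x + S.Lam y := S.LamL.map_add x y
theorem Lam_sub (x y : S.Vec) : S.Lam (x - y) = S.Lam x - S.Lam y := S.LamL.map_sub x y
theorem Lam_smul (c : ℝ) (x : S.Vec) : S.Lam (c • x) = c • S.Lam x := S.LamL.map_smul c x

theorem exists_eq_sum_squareVec {s : S.Vec} (hs : s ∈ S.cone) :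
    ∃ (l : Fin m → ℕ) (b : (i : Fin m) → Fin (l i) → Fin (S.L i) → ℝ),
      s = ∑ i, ∑ j, S.squareVec i (b i j) := by
  obtain ⟨σ, hσ, e⟩ := hs
  choose l h hmem hsum using hσ
  refine ⟨l, fun i j => (S.p i).equivFun ⟨h i j, hmem i j⟩, S.toPoly_injective ?_⟩
  simp only [squareVec_equivFun]
  simp only [← map_sum]
  rw [e, toPoly_equivFun]
  simp [hsum, weightedMul, Finset.mul_sum, sq]

theorem mem_dualCone_iff {x : S.Vec} : x ∈ S.dualCone ↔ (S.Lam x).PosSemidef := by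
  constructor
  · intro hx
    refine .of_dotProduct_mulVec_nonneg ?_ fun v => ?_
    · simpa [Matrix.IsHermitian] using S.Lam_transpose x
    · rw [star_trivial, dotProduct_Lam_mulVec]
      exact hx _ (S.sum_mem_cone _ _ fun i _ => S.squareVec_mem_cone _ _)
  · intro hx s hs
    obtain ⟨l, b, rfl⟩ := S.exists_eq_sum_squareVec hs
    simp only [sum_dotProduct]
    refine Finset.sum_nonneg fun i _ => Finset.sum_nonneg fun j _ => ?_
    -- Test vector supported on the block i alone.
    have h := hx.dotProduct_mulVec_nonneg fun k => if hk : k.1 = i then b i j (hk ▸ k.2) else 0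
    rw [star_trivial, dotProduct_Lam_mulVec, sum_dotProduct, Finset.sum_eq_single i] at h
    · simpa using h
    · intro k _ hk
      simp only [hk, dite_false]
      rw [squareVec_dotProduct]
      simp [dotProduct]
    · simp

/-- The adjoint of Λ maps positive semidefinite matrices into Σ: with M = C², each row of C
contributes one weighted square per block. -/
theorem exists_mem_cone_of_posSemidef {M : Matrix (Σ i, Fin (S.L i)) (Σ i, Fin (S.L i)) ℝ}
    (hM : M.PosSemidef) : ∃ s ∈ S.cone, ∀ x, s ⬝ᵥ x = (M * S.Lam x).trace := by
  obtain ⟨C, hC, rfl⟩ := exists_symm_sq_eq hM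
  refine ⟨∑ a, ∑ i, S.squareVec i fun j => C a ⟨i, j⟩, S.sum_mem_cone _ _ fun a _ =>
    S.sum_mem_cone _ _ fun i _ => S.squareVec_mem_cone _ _, fun x => ?_⟩
  rw [sum_dotProduct]
  simp only [← S.dotProduct_Lam_mulVec (C _)]
  rw [Matrix.mul_assoc, Matrix.trace_mul_comm]
  nth_rewrite 4 [← hC]
  simp only [Matrix.trace, Matrix.diag_apply]
  refine Finset.sum_congr rfl fun a _ => ?_
  rw [Matrix.dotProduct_mulVec]
  simp only [Matrix.mul_apply, dotProduct, Matrix.vecMul, Matrix.transpose_apply]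

theorem continuous_Lam : Continuous S.Lam :=
  LinearMap.continuous_of_finiteDimensional S.LamL

theorem mem_interior_dualCone_iff {x : S.Vec} :
    x ∈ interior S.dualCone ↔ (S.Lam x).PosDef := by
  constructor
  · intro hx
    have hpos : ∀ (i : Fin m) (b : Fin (S.L i) → ℝ), b ≠ 0 → 0 < S.squareVec i b ⬝ᵥ x := by
      intro i b hb
      set s := S.squareVec i b
      -- Moving from x a little in the direction -s stays in Σ*, so ⟨s, x⟩ ≥ ε⟨s, s⟩ > 0.
      have ht : Tendsto (fun ε : ℝ => x - ε • s) (𝓝[>] 0) (𝓝 x) := by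
        have : Continuous fun ε : ℝ => x - ε • s := by fun_prop
        simpa using (this.tendsto 0).mono_left nhdsWithin_le_nhds
      obtain ⟨ε, h1, h2⟩ := ((ht.eventually (mem_interior_iff_mem_nhds.1 hx)).and
        self_mem_nhdsWithin).exists
      have h3 := h1 s (S.squareVec_mem_cone i b)
      rw [dotProduct_sub, dotProduct_smul, smul_eq_mul] at h3
      have h4 : 0 < s ⬝ᵥ s := by
        simpa using dotProduct_star_self_pos_iff.2 (S.squareVec_ne_zero i hb)
      have := mul_pos (Set.mem_Ioi.1 h2) h4
      linarith
    have hpsd := S.mem_dualCone_iff.1 (interior_subset hx)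
    refine .of_dotProduct_mulVec_pos hpsd.isHermitian fun v hv => ?_
    rw [star_trivial, dotProduct_Lam_mulVec, sum_dotProduct]
    obtain ⟨⟨i, j⟩, hij⟩ := Function.ne_iff.1 hv
    refine Finset.sum_pos' (fun k _ => interior_subset hx _ (S.squareVec_mem_cone _ _))
      ⟨i, Finset.mem_univ _, hpos i _ fun h => hij ?_⟩
    exact congrFun h j
  · intro hx
    rw [mem_interior_iff_mem_nhds]
    -- The open local unit ball around x is a neighbourhood on which Λ stays positive definite.
    have hc : Continuous fun y => ((S.Lam x)⁻¹ * S.Lam (y - x) * (S.Lam x)⁻¹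
        * S.Lam (y - x)).trace := by
      have := S.continuous_Lam
      fun_prop
    have h0 : ((S.Lam x)⁻¹ * S.Lam (x - x) * (S.Lam x)⁻¹ * S.Lam (x - x)).trace < 1 := by
      rw [Lam_sub, sub_self]; simp
    filter_upwards [hc.continuousAt.eventually_lt continuousAt_const h0] with y hy
    have := posDef_add hx (S.Lam_transpose _) hy
    rw [← Lam_add, add_sub_cancel] at this
    exact S.mem_dualCone_iff.2 this.posSemidef

/-! ### Gradient and Hessian of the barrier in closed form. -/

theorem hasDerivAt_det_line {ι : Type*} [Fintype ι] [DecidableEq ι] {X : Matrix ι ι ℝ}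
    (hX : IsUnit X.det) (V : Matrix ι ι ℝ) :
    HasDerivAt (fun t : ℝ => (X + t • V).det) (X.det * (X⁻¹ * V).trace) 0 := by
  have e : (fun t : ℝ => (X + t • V).det) = fun t => X.det * (1 + t • (X⁻¹ * V)).det := by
    ext t
    rw [← Matrix.det_mul, Matrix.mul_add, Matrix.mul_one, Matrix.mul_smul,
      Matrix.mul_nonsing_inv_cancel_left _ _ hX]
  rw [e]
  refine HasDerivAt.const_mul _ ?_
  rw [funext fun t : ℝ => Matrix.det_one_add_smul t (X⁻¹ * V)]
  -- P collects the terms of order at least two, det(1 + tA) = 1 + t tr A + t² P(t), which do not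
  -- affect the derivative at 0.
  set P := (Matrix.det (1 + (Polynomial.X : Polynomial ℝ) • (X⁻¹ * V).map Polynomial.C)).divX.divX
  have h := (((hasDerivAt_id (0 : ℝ)).const_mul (X⁻¹ * V).trace).const_add 1).add
    ((P.hasDerivAt 0).mul (hasDerivAt_pow 2 (0 : ℝ)))
  exact h.congr_deriv (by simp)

theorem differentiable_det_Lam : Differentiable ℝ fun x => (S.Lam x).det := by
  have h : ∀ a b, Differentiable ℝ fun x => S.Lam x a b := fun a b =>
    (LinearMap.toContinuousLinearMap ((Matrix.entryLinearMap ℝ ℝ a b).comp S.LamL)).differentiable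
  simp only [Matrix.det_apply]
  fun_prop

theorem fderiv_barrier {x : S.Vec} (hx : (S.Lam x).PosDef) (v : S.Vec) :
    fderiv ℝ S.barrier x v = -((S.Lam x)⁻¹ * S.Lam v).trace := by
  have hd : DifferentiableAt ℝ S.barrier x :=
    ((S.differentiable_det_Lam x).log hx.det_pos.ne').neg
  have hl : HasDerivAt (fun t : ℝ => x + t • v) v 0 := by
    simpa using ((hasDerivAt_id (0 : ℝ)).smul_const v).const_add x
  have h1 : HasDerivAt (fun t : ℝ => S.barrier (x + t • v)) (fderiv ℝ S.barrier x v) 0 := by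
    have hd' : HasFDerivAt S.barrier (fderiv ℝ S.barrier x) (x + (0 : ℝ) • v) := by
      simpa using hd.hasFDerivAt
    exact hd'.comp_hasDerivAt (0 : ℝ) hl
  have h2 := ((hasDerivAt_det_line (isUnit_iff_ne_zero.2 hx.det_pos.ne') (S.Lam v)).log
    (by simpa using hx.det_pos.ne')).neg
  have e : (fun t : ℝ => S.barrier (x + t • v))
      = -fun t : ℝ => Real.log (S.Lam x + t • S.Lam v).det := by
    ext t; simp [barrier, Lam_add, Lam_smul]
  rw [e] at h1
  rw [h1.unique h2]
  have := hx.det_pos.ne'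
  simp only [zero_smul, add_zero]
  field_simp

theorem grad_apply {x : S.Vec} (hx : (S.Lam x).PosDef) (u : Fin S.U) :
    S.grad x u = -((S.Lam x)⁻¹ * S.Lam (Pi.single u 1)).trace := S.fderiv_barrier hx _

theorem hess_apply {x : S.Vec} (hx : (S.Lam x).PosDef) (u v : Fin S.U) :
    S.hess x u v = ((S.Lam x)⁻¹ * S.Lam (Pi.single u 1) * (S.Lam x)⁻¹
      * S.Lam (Pi.single v 1)).trace := by
  rw [hess, Matrix.of_apply]
  -- The closed form of the gradient is known only where Λ is positive definite; that set is open,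
  -- which suffices for the derivative at x.
  have hev : (fun z => S.grad z v) =ᶠ[𝓝 x]
      fun z => -((S.Lam z)⁻¹ * S.Lam (Pi.single v 1)).trace := by
    filter_upwards [isOpen_interior.mem_nhds (S.mem_interior_dualCone_iff.2 hx)] with z hz
    exact S.grad_apply (S.mem_interior_dualCone_iff.1 hz) v
  rw [hev.fderiv_eq]
  obtain ⟨X, hX⟩ := hx.isUnit
  have h1 : HasFDerivAt S.Lam (LinearMap.toContinuousLinearMap S.LamL) x :=
    (LinearMap.toContinuousLinearMap S.LamL).hasFDerivAt
  have h2 := hasFDerivAt_ringInverse (𝕜 := ℝ) X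
  rw [hX] at h2
  have h3 := h2.comp x h1
  set T : Matrix (Σ i, Fin (S.L i)) (Σ i, Fin (S.L i)) ℝ →L[ℝ] ℝ :=
    LinearMap.toContinuousLinearMap ((Matrix.traceLinearMap _ ℝ ℝ).comp
      (LinearMap.mulRight ℝ (S.Lam (Pi.single v 1)))) with hT
  have h4 := (T.hasFDerivAt.comp x h3).neg
  have e : (fun z => -((S.Lam z)⁻¹ * S.Lam (Pi.single v 1)).trace)
      = -(T ∘ Ring.inverse ∘ S.Lam) := by
    ext z
    simp [hT, Matrix.nonsing_inv_eq_ringInverse]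
  rw [e, h4.fderiv]
  have hXi : (↑X⁻¹ : Matrix (Σ i, Fin (S.L i)) (Σ i, Fin (S.L i)) ℝ) = (S.Lam x)⁻¹ := by
    rw [← hX, Matrix.coe_units_inv]
  simp [hT, hXi, LamL, Matrix.mul_assoc]

theorem grad_dotProduct {x : S.Vec} (hx : (S.Lam x).PosDef) (v : S.Vec) :
    S.grad x ⬝ᵥ v = -((S.Lam x)⁻¹ * S.Lam v).trace := by
  rw [← S.fderiv_barrier hx]
  conv_rhs => rw [pi_eq_sum_univ' v]
  simp [map_sum, dotProduct, grad, mul_comm]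

theorem hess_dotProduct {x : S.Vec} (hx : (S.Lam x).PosDef) (u v : S.Vec) :
    u ⬝ᵥ S.hess x *ᵥ v = ((S.Lam x)⁻¹ * S.Lam u * (S.Lam x)⁻¹ * S.Lam v).trace := by
  have e : ∀ v : S.Vec, S.Lam v = ∑ k, v k • S.Lam (Pi.single k 1) := fun v => by
    conv_lhs => rw [pi_eq_sum_univ' v]
    exact (map_sum S.LamL _ _).trans (Finset.sum_congr rfl fun k _ => S.LamL.map_smul _ _)
  rw [e u, e v]
  simp only [dotProduct, Matrix.mulVec, S.hess_apply hx, Matrix.sum_mul,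
    Matrix.trace_sum, Matrix.mul_smul, Matrix.smul_mul, Matrix.trace_smul, smul_eq_mul,
    Finset.mul_sum]
  rw [Finset.sum_comm]
  refine Finset.sum_congr rfl fun j _ => Finset.sum_congr rfl fun k _ => ?_
  ring

end Setup

/-! ### Local norms and how they vary with the base point. -/

theorem inv_smul_of_ne_zero {ι : Type*} [Fintype ι] [DecidableEq ι] {X : Matrix ι ι ℝ}
    (hX : IsUnit X.det) {c : ℝ} (hc : c ≠ 0) : (c • X)⁻¹ = c⁻¹ • X⁻¹ := by
  refine Matrix.inv_eq_left_inv ?_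
  rw [Matrix.smul_mul, Matrix.mul_smul, Matrix.nonsing_inv_mul _ hX, smul_smul,
    inv_mul_cancel₀ hc, one_smul]

theorem _root_.Matrix.PosDef.isUnit_det {ι : Type*} [Fintype ι] [DecidableEq ι]
    {X : Matrix ι ι ℝ} (hX : X.PosDef) : IsUnit X.det := isUnit_iff_ne_zero.2 hX.det_pos.ne'

namespace Setup

variable {n m : ℕ} (S : Setup n m)

theorem localNorm_eq (x v : S.Vec) : S.localNorm x v = formNorm (S.hess x) v := rfl

theorem dualNorm_eq (x v : S.Vec) : S.dualNorm x v = formNorm (S.hess x)⁻¹ v := rfl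

theorem localNorm_nonneg (x v : S.Vec) : 0 ≤ S.localNorm x v := Real.sqrt_nonneg _

theorem dualNorm_nonneg (x v : S.Vec) : 0 ≤ S.dualNorm x v := Real.sqrt_nonneg _

/-- Such a v is orthogonal to all of Σ, in particular to e and to e + εv for small ε > 0, whence ⟨v,
v⟩ = 0. -/
theorem eq_zero_of_mem_dualCone (hS : (interior S.cone).Nonempty) {v : S.Vec}
    (h₁ : v ∈ S.dualCone) (h₂ : -v ∈ S.dualCone) : v = 0 := by
  obtain ⟨e, he⟩ := hS
  have h0 : ∀ s ∈ S.cone, s ⬝ᵥ v = 0 := fun s hs => by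
    have := h₂ s hs
    rw [dotProduct_neg] at this
    linarith [h₁ s hs]
  have ht : Tendsto (fun ε : ℝ => e + ε • v) (𝓝[>] 0) (𝓝 e) := by
    have : Continuous fun ε : ℝ => e + ε • v := by fun_prop
    simpa using (this.tendsto 0).mono_left nhdsWithin_le_nhds
  obtain ⟨ε, h3, h4⟩ := ((ht.eventually (mem_interior_iff_mem_nhds.1 he)).and
    self_mem_nhdsWithin).exists
  have h5 := h0 _ h3
  rw [add_dotProduct, h0 e (interior_subset he), smul_dotProduct, zero_add, smul_eq_mul,
    mul_eq_zero] at h5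
  exact dotProduct_self_eq_zero.1 (h5.resolve_left (ne_of_gt h4))

section

variable {S}

/-- If vᵀHv ≤ 0, then Λ(v) and Λ(-v) are both positive semidefinite, so v = 0 because Σ* is pointed.
-/
theorem hess_posDef (hS : (interior S.cone).Nonempty) {x : S.Vec}
    (hx : (S.Lam x).PosDef) : (S.hess x).PosDef := by
  refine .of_dotProduct_mulVec_pos ?_ fun v hv => ?_
  · ext i j
    rw [Matrix.conjTranspose_apply, star_trivial, S.hess_apply hx, S.hess_apply hx,
      Matrix.mul_assoc, Matrix.trace_mul_comm, ← Matrix.mul_assoc]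
  · rw [star_trivial, S.hess_dotProduct hx]
    by_contra hle
    have h1 : ∀ D, Dᵀ = D → ((S.Lam x)⁻¹ * D * (S.Lam x)⁻¹ * D).trace ≤ 0 → D.PosSemidef :=
      fun D hD h => by
        simpa using posSemidef_smul_add hx hD le_rfl (by simpa using h)
    refine hv (S.eq_zero_of_mem_dualCone hS ?_ ?_)
    · exact S.mem_dualCone_iff.2 (h1 _ (S.Lam_transpose v) (not_lt.1 hle))
    · refine S.mem_dualCone_iff.2 (h1 _ (S.Lam_transpose _) ?_)
      have : S.Lam (-v) = -S.Lam v := S.LamL.map_neg v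
      simpa [this] using not_lt.1 hle

end

theorem hess_mulVec_self {x : S.Vec} (hx : (S.Lam x).PosDef) :
    S.hess x *ᵥ x = -S.grad x := by
  ext u
  have h := S.hess_dotProduct hx (Pi.single u 1) x
  rw [single_one_dotProduct] at h
  rw [h, Pi.neg_apply, S.grad_apply hx, neg_neg,
    Matrix.mul_assoc _ (S.Lam x)⁻¹, Matrix.nonsing_inv_mul _ hx.isUnit_det, Matrix.mul_one]

theorem grad_dotProduct_self {x : S.Vec} (hx : (S.Lam x).PosDef) :
    S.grad x ⬝ᵥ x = -(Fintype.card (Σ i, Fin (S.L i)) : ℝ) := by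
  rw [S.grad_dotProduct hx, Matrix.nonsing_inv_mul _ hx.isUnit_det, Matrix.trace_one]

section

variable {S}

theorem localNorm_sq (hS : (interior S.cone).Nonempty) {x : S.Vec} (hx : (S.Lam x).PosDef)
    (v : S.Vec) : S.localNorm x v ^ 2
      = ((S.Lam x)⁻¹ * S.Lam v * (S.Lam x)⁻¹ * S.Lam v).trace := by
  rw [localNorm_eq, formNorm_sq (hess_posDef hS hx).posSemidef, S.hess_dotProduct hx]

theorem localNorm_self (hS : (interior S.cone).Nonempty) {x : S.Vec} (hx : (S.Lam x).PosDef) :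
    S.localNorm x x ^ 2 = Fintype.card (Σ i, Fin (S.L i)) := by
  rw [localNorm_sq hS hx, Matrix.nonsing_inv_mul _ hx.isUnit_det, Matrix.one_mul,
    Matrix.nonsing_inv_mul _ hx.isUnit_det, Matrix.trace_one]

theorem localNorm_inv_mulVec (hS : (interior S.cone).Nonempty) {x : S.Vec}
    (hx : (S.Lam x).PosDef) (t : S.Vec) :
    S.localNorm x ((S.hess x)⁻¹ *ᵥ t) = S.dualNorm x t :=
  formNorm_inv_mulVec (hess_posDef hS hx) t

theorem dualNorm_add_le (hS : (interior S.cone).Nonempty) {x : S.Vec}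
    (hx : (S.Lam x).PosDef) (s t : S.Vec) :
    S.dualNorm x (s + t) ≤ S.dualNorm x s + S.dualNorm x t :=
  formNorm_add_le (hess_posDef hS hx).inv.posSemidef s t

theorem dualNorm_neg (x t : S.Vec) : S.dualNorm x (-t) = S.dualNorm x t := formNorm_neg t

theorem dualNorm_smul (x t : S.Vec) (c : ℝ) : S.dualNorm x (c • t) = |c| * S.dualNorm x t :=
  formNorm_smul c t

theorem sub_inv_mulVec (hS : (interior S.cone).Nonempty) {x : S.Vec} (hx : (S.Lam x).PosDef)
    (t : S.Vec) : x - (S.hess x)⁻¹ *ᵥ t = (S.hess x)⁻¹ *ᵥ (-S.grad x - t) := by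
  rw [Matrix.mulVec_sub, ← S.hess_mulVec_self hx, inv_mulVec_mulVec (hess_posDef hS hx)]

theorem localNorm_sub_inv_mulVec (hS : (interior S.cone).Nonempty) {x : S.Vec}
    (hx : (S.Lam x).PosDef) (t : S.Vec) :
    S.localNorm x (x - (S.hess x)⁻¹ *ᵥ t) = S.dualNorm x (-S.grad x - t) := by
  rw [sub_inv_mulVec hS hx, localNorm_inv_mulVec hS hx]

/-- If `ℓ` is represented by the matrix `M`, then its dual norm at `y` is at most the Frobenius
norm of `M` scaled by `Λ y`. -/
theorem dualNorm_sq_le (hS : (interior S.cone).Nonempty) {y : S.Vec} (hy : (S.Lam y).PosDef)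
    {M : Matrix (Σ i, Fin (S.L i)) (Σ i, Fin (S.L i)) ℝ} (hM : Mᵀ = M) {l : S.Vec}
    (hl : ∀ v, l ⬝ᵥ v = (M * S.Lam v).trace) :
    S.dualNorm y l ^ 2 ≤ (M * S.Lam y * M * S.Lam y).trace := by
  -- Tested at v = H(y)⁻¹l, both l(v) and ‖v‖_y² equal ‖l‖*_y², so Cauchy-Schwarz bounds its square
  -- by itself times the right-hand side; one factor cancels unless it is zero.
  have h := trace_mul_sq_le_of_posDef hy hM (S.Lam_transpose ((S.hess y)⁻¹ *ᵥ l))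
  rw [← hl, ← localNorm_sq hS hy, localNorm_inv_mulVec hS hy] at h
  have e : l ⬝ᵥ (S.hess y)⁻¹ *ᵥ l = S.dualNorm y l ^ 2 :=
    (formNorm_sq (hess_posDef hS hy).inv.posSemidef l).symm
  rw [e, sq (S.dualNorm y l ^ 2)] at h
  have h0 : 0 ≤ (M * S.Lam y * M * S.Lam y).trace := by
    refine trace_mul_nonneg ?_ hy.posSemidef
    have := hy.posSemidef.mul_mul_conjTranspose_same M
    rwa [Matrix.conjTranspose_eq_transpose_of_trivial, hM] at this
  rcases (sq_nonneg (S.dualNorm y l)).eq_or_lt with h1 | h1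
  · rwa [← h1]
  · exact le_of_mul_le_mul_right h h1

theorem posDef_of_localNorm_lt (hS : (interior S.cone).Nonempty) {x y : S.Vec}
    (hx : (S.Lam x).PosDef) (h : S.localNorm x (y - x) < 1) : (S.Lam y).PosDef := by
  have h1 : S.localNorm x (y - x) ^ 2 < 1 := by
    have := S.localNorm_nonneg x (y - x); nlinarith
  rw [localNorm_sq hS hx] at h1
  have := posDef_add hx (S.Lam_transpose _) h1
  rwa [← Lam_add, add_sub_cancel] at this

theorem inv_transpose_of_posDef {ι : Type*} [Fintype ι] [DecidableEq ι] {X : Matrix ι ι ℝ}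
    (hX : X.PosDef) : (X⁻¹)ᵀ = X⁻¹ := by
  simpa [Matrix.IsHermitian] using hX.inv.isHermitian

/-- The symmetric matrix `Λ(x)⁻¹ Λ(v) Λ(x)⁻¹` represents `H(x) v`. -/
theorem dotProduct_eq_trace_mul (hS : (interior S.cone).Nonempty) {x : S.Vec}
    (hx : (S.Lam x).PosDef) (t w : S.Vec) :
    t ⬝ᵥ w = ((S.Lam x)⁻¹ * S.Lam ((S.hess x)⁻¹ *ᵥ t) * (S.Lam x)⁻¹ * S.Lam w).trace := by
  rw [Matrix.mul_assoc, Matrix.trace_mul_comm, ← Matrix.mul_assoc, ← S.hess_dotProduct hx,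
    mulVec_inv_mulVec (hess_posDef hS hx), dotProduct_comm]

/-- The matrix M representing t has scaled Frobenius norm exactly ‖t‖*_x at x, and Λ(y) ≤ (1 +
δ)Λ(x) in the semidefinite order with δ = ‖y - x‖_x. -/
theorem dualNorm_le_mul_dualNorm (hS : (interior S.cone).Nonempty) {x y : S.Vec}
    (hx : (S.Lam x).PosDef) (hy : (S.Lam y).PosDef) (t : S.Vec) :
    S.dualNorm y t ≤ (1 + S.localNorm x (y - x)) * S.dualNorm x t := by
  set δ := S.localNorm x (y - x) with hδ
  have hδ0 : 0 ≤ δ := S.localNorm_nonneg _ _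
  set v := (S.hess x)⁻¹ *ᵥ t with hv
  set M := (S.Lam x)⁻¹ * S.Lam v * (S.Lam x)⁻¹ with hMd
  have hXi := inv_transpose_of_posDef hx
  have hM : Mᵀ = M := by
    simp only [hMd, Matrix.transpose_mul, hXi, S.Lam_transpose, Matrix.mul_assoc]
  have h1 := dualNorm_sq_le hS hy hM (fun w => dotProduct_eq_trace_mul hS hx t w)
  have hneg : S.Lam (x - y) = -S.Lam (y - x) := by rw [Lam_sub, Lam_sub, neg_sub]
  have h2 : ((1 + δ) • S.Lam x - S.Lam y).PosSemidef := by
    have := posSemidef_smul_add hx (S.Lam_transpose (x - y)) hδ0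
      (by rw [hneg, hδ, localNorm_sq hS hx]; simp)
    convert this using 1
    rw [Lam_sub]; module
  have h3 : ((1 + δ) • S.Lam x + S.Lam y).PosSemidef :=
    (hx.posSemidef.smul (by linarith)).add hy.posSemidef
  have h4 := trace_mul_mul_mul_mono h2 h3 hM
  have h5 : (M * S.Lam x * M * S.Lam x).trace = S.dualNorm x t ^ 2 := by
    rw [← localNorm_inv_mulVec hS hx, localNorm_sq hS hx]
    simp only [hMd, Matrix.mul_assoc, Matrix.nonsing_inv_mul _ hx.isUnit_det, Matrix.mul_one, ← hv]
  have h6 : (M * ((1 + δ) • S.Lam x) * M * ((1 + δ) • S.Lam x)).trace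
      = ((1 + δ) * S.dualNorm x t) ^ 2 := by
    simp only [Matrix.mul_smul, Matrix.smul_mul, Matrix.trace_smul, h5, smul_eq_mul]
    ring
  refine (abs_le_of_sq_le_sq' ?_ (mul_nonneg (by linarith) (S.dualNorm_nonneg _ _))).2
  exact h1.trans (h4.trans h6.le)

/-- The difference is represented by M = Λ(x)⁻¹ - Λ(y)⁻¹, and M Λ(y) = Λ(x)⁻¹Λ(y - x) exactly.
Measuring at y rather than x thus avoids any factor 1/(1 - δ). -/
theorem dualNorm_grad_sub_grad_le (hS : (interior S.cone).Nonempty) {x y : S.Vec}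
    (hx : (S.Lam x).PosDef) (hy : (S.Lam y).PosDef) :
    S.dualNorm y (S.grad y - S.grad x) ≤ S.localNorm x (y - x) := by
  have hM : ((S.Lam x)⁻¹ - (S.Lam y)⁻¹)ᵀ = (S.Lam x)⁻¹ - (S.Lam y)⁻¹ := by
    rw [Matrix.transpose_sub, inv_transpose_of_posDef hx, inv_transpose_of_posDef hy]
  have h := dualNorm_sq_le hS hy hM (l := S.grad y - S.grad x) fun v => by
    rw [sub_dotProduct, S.grad_dotProduct hx, S.grad_dotProduct hy, Matrix.sub_mul,
      Matrix.trace_sub]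
    ring
  have e : ((S.Lam x)⁻¹ - (S.Lam y)⁻¹) * S.Lam y = (S.Lam x)⁻¹ * S.Lam (y - x) := by
    rw [Lam_sub, Matrix.mul_sub, Matrix.sub_mul, Matrix.nonsing_inv_mul _ hx.isUnit_det,
      Matrix.nonsing_inv_mul _ hy.isUnit_det]
  rw [Matrix.mul_assoc, e, ← Matrix.mul_assoc, ← localNorm_sq hS hx] at h
  exact (abs_le_of_sq_le_sq' h (S.localNorm_nonneg _ _)).2

/-- Quadratic convergence of Newton's method for the equation `-g(x) = t`. -/
theorem dualNorm_newton_le (hS : (interior S.cone).Nonempty) {x y t : S.Vec}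
    (hx : (S.Lam x).PosDef) (hy : (S.Lam y).PosDef)
    (hxy : y = (2 : ℝ) • x - (S.hess x)⁻¹ *ᵥ t) :
    S.dualNorm y (-S.grad y - t) ≤ S.dualNorm x (-S.grad x - t) ^ 2 := by
  have hd : y - x = (S.hess x)⁻¹ *ᵥ (-S.grad x - t) := by
    rw [← sub_inv_mulVec hS hx, hxy]; module
  have ht : t = -S.grad x - S.hess x *ᵥ (y - x) := by
    rw [hd, mulVec_inv_mulVec (hess_posDef hS hx)]; abel
  have hXi := inv_transpose_of_posDef hx
  set X := S.Lam x with hX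
  set D := S.Lam (y - x) with hD
  have hDt : Dᵀ = D := S.Lam_transpose _
  have hY : S.Lam y = X + D := by rw [hD, Lam_sub]; abel
  -- The second-order remainder of matrix inversion; it satisfies M Λ(y) = X⁻¹(D X⁻¹ D), and since D
  -- X⁻¹ D is positive semidefinite the Frobenius norm is at most the trace, which is ‖y - x‖_x².
  set M := (S.Lam y)⁻¹ - X⁻¹ + X⁻¹ * D * X⁻¹ with hMd
  have hM : Mᵀ = M := by
    simp only [hMd, Matrix.transpose_add, Matrix.transpose_sub, Matrix.transpose_mul, hXi, hDt,
      inv_transpose_of_posDef hy, Matrix.mul_assoc]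
  have h := dualNorm_sq_le hS hy hM (l := -S.grad y - t) fun v => by
    have e1 : (S.hess x *ᵥ (y - x)) ⬝ᵥ v = (X⁻¹ * D * X⁻¹ * S.Lam v).trace := by
      rw [dotProduct_comm, S.hess_dotProduct hx, Matrix.mul_assoc, Matrix.trace_mul_comm,
        ← Matrix.mul_assoc]
    rw [ht, sub_dotProduct, sub_dotProduct, neg_dotProduct, neg_dotProduct,
      S.grad_dotProduct hx, S.grad_dotProduct hy, e1, Matrix.add_mul, Matrix.sub_mul,
      Matrix.trace_add, Matrix.trace_sub]
    ring
  have e : M * S.Lam y = X⁻¹ * (D * X⁻¹ * D) := by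
    rw [hMd, Matrix.add_mul, Matrix.sub_mul, Matrix.nonsing_inv_mul _ hy.isUnit_det, hY,
      Matrix.mul_add, Matrix.mul_add, Matrix.nonsing_inv_mul _ hx.isUnit_det,
      Matrix.mul_assoc (X⁻¹ * D), Matrix.nonsing_inv_mul _ hx.isUnit_det, Matrix.mul_one]
    simp only [Matrix.mul_assoc]
    abel
  have hQ : (D * X⁻¹ * D).PosSemidef := by
    have := hx.inv.posSemidef.mul_mul_conjTranspose_same D
    rwa [Matrix.conjTranspose_eq_transpose_of_trivial, hDt] at this
  have h2 := trace_mul_mul_mul_le_sq hx.inv.posSemidef hQ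
  rw [Matrix.mul_assoc, e, ← Matrix.mul_assoc] at h
  have h3 : (X⁻¹ * (D * X⁻¹ * D)).trace = S.dualNorm x (-S.grad x - t) ^ 2 := by
    rw [← localNorm_inv_mulVec hS hx, ← hd, localNorm_sq hS hx]
    simp only [Matrix.mul_assoc, ← hX, ← hD]
  rw [h3] at h2
  exact (abs_le_of_sq_le_sq' (h.trans h2) (sq_nonneg _)).2

/-- Since ⟨-g(x), x⟩ = ν, the excess of ⟨t, x⟩ over ν is the pairing of t + g(x) with x. -/
theorem dotProduct_self_le (hS : (interior S.cone).Nonempty) {x : S.Vec}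
    (hx : (S.Lam x).PosDef) (t : S.Vec) :
    t ⬝ᵥ x ≤ Fintype.card (Σ i, Fin (S.L i)) + S.dualNorm x (-S.grad x - t) * S.localNorm x x := by
  have h := dotProduct_le_formNorm (hess_posDef hS hx) (-(-S.grad x - t)) x
  rw [formNorm_neg, ← dualNorm_eq, ← localNorm_eq] at h
  have e : -(-S.grad x - t) ⬝ᵥ x = t ⬝ᵥ x + S.grad x ⬝ᵥ x := by
    rw [← add_dotProduct]; congr 1; abel
  rw [e, S.grad_dotProduct_self hx] at h
  linarith

/-- Here the representing matrix Λ(x₀)⁻¹ is positive definite, so its Frobenius norm scaled by Λ(x)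
is at most tr(Λ(x₀)⁻¹Λ(x)). -/
theorem dualNorm_neg_grad_le (hS : (interior S.cone).Nonempty) {x x₀ : S.Vec}
    (hx : (S.Lam x).PosDef) (hx₀ : (S.Lam x₀).PosDef) :
    S.dualNorm x (-S.grad x₀) ≤ -S.grad x₀ ⬝ᵥ x := by
  have h := dualNorm_sq_le hS hx (inv_transpose_of_posDef hx₀) (l := -S.grad x₀) fun v => by
    rw [neg_dotProduct, S.grad_dotProduct hx₀, neg_neg]
  have h2 := trace_mul_mul_mul_le_sq hx₀.inv.posSemidef hx.posSemidef
  have e : ((S.Lam x₀)⁻¹ * S.Lam x).trace = -S.grad x₀ ⬝ᵥ x := by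
    rw [neg_dotProduct, S.grad_dotProduct hx₀, neg_neg]
  rw [e] at h2
  refine (abs_le_of_sq_le_sq' (h.trans h2) ?_).2
  rw [← e]
  exact trace_mul_nonneg hx₀.inv.posSemidef hx.posSemidef

/-- With v = H(x₀)⁻¹t and K = ‖t‖*_{x₀}, one has -KΛ(x₀) ≤ Λ(v) ≤ KΛ(x₀). So t costs at most K times
what -g(x₀) does. It bounds ‖e‖*_x uniformly along the iterates. -/
theorem dualNorm_le_mul_dotProduct (hS : (interior S.cone).Nonempty) {x x₀ : S.Vec}
    (hx : (S.Lam x).PosDef) (hx₀ : (S.Lam x₀).PosDef) (t : S.Vec) :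
    S.dualNorm x t ≤ S.dualNorm x₀ t * (-S.grad x₀ ⬝ᵥ x) := by
  set K := S.dualNorm x₀ t with hK
  have hK0 : 0 ≤ K := S.dualNorm_nonneg _ _
  set v := (S.hess x₀)⁻¹ *ᵥ t with hv
  have hXi := inv_transpose_of_posDef hx₀
  set X := S.Lam x₀ with hX
  have hM : (X⁻¹ * S.Lam v * X⁻¹)ᵀ = X⁻¹ * S.Lam v * X⁻¹ := by
    simp only [Matrix.transpose_mul, hXi, S.Lam_transpose, Matrix.mul_assoc]
  have h1 := dualNorm_sq_le hS hx hM (fun w => dotProduct_eq_trace_mul hS hx₀ t w)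
  set N := X⁻¹ * S.Lam x * X⁻¹ with hN
  have hNt : Nᵀ = N := by
    simp only [hN, Matrix.transpose_mul, hXi, S.Lam_transpose, Matrix.mul_assoc]
  have e1 : (X⁻¹ * S.Lam v * X⁻¹ * S.Lam x * (X⁻¹ * S.Lam v * X⁻¹) * S.Lam x).trace
      = (N * S.Lam v * N * S.Lam v).trace := by
    have : X⁻¹ * S.Lam v * X⁻¹ * S.Lam x * (X⁻¹ * S.Lam v * X⁻¹) * S.Lam x
        = X⁻¹ * S.Lam v * (N * S.Lam v * (X⁻¹ * S.Lam x)) := by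
      simp only [hN, Matrix.mul_assoc]
    rw [this, Matrix.trace_mul_comm]
    simp only [hN, Matrix.mul_assoc]
  have hτ : (X⁻¹ * S.Lam v * X⁻¹ * S.Lam v).trace = K ^ 2 := by
    rw [hK, ← localNorm_inv_mulVec hS hx₀, localNorm_sq hS hx₀]
  have hneg : S.Lam (-v) = -S.Lam v := S.LamL.map_neg v
  have h2 : (K • X - S.Lam v).PosSemidef := by
    have := posSemidef_smul_add hx₀ (S.Lam_transpose (-v)) hK0
      (by rw [hneg, ← hτ]; simp)
    rwa [hneg, ← sub_eq_add_neg] at this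
  have h3 := posSemidef_smul_add hx₀ (S.Lam_transpose v) hK0 hτ.le
  have h4 := trace_mul_mul_mul_mono h2 h3 hNt
  have h5 : (N * (K • X) * N * (K • X)).trace
      = K ^ 2 * (X⁻¹ * S.Lam x * X⁻¹ * S.Lam x).trace := by
    have : N * X = X⁻¹ * S.Lam x := by
      rw [hN, Matrix.mul_assoc, Matrix.nonsing_inv_mul _ hx₀.isUnit_det, Matrix.mul_one]
    rw [Matrix.mul_assoc _ N]
    simp only [Matrix.mul_smul, Matrix.smul_mul, Matrix.trace_smul, this, smul_eq_mul,
      ← Matrix.mul_assoc]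
    ring
  have h6 := trace_mul_mul_mul_le_sq hx₀.inv.posSemidef hx.posSemidef
  have e : (X⁻¹ * S.Lam x).trace = -S.grad x₀ ⬝ᵥ x := by
    rw [neg_dotProduct, S.grad_dotProduct hx₀, neg_neg]
  rw [e] at h6
  have h7 : 0 ≤ -S.grad x₀ ⬝ᵥ x := by
    rw [← e]; exact trace_mul_nonneg hx₀.inv.posSemidef hx.posSemidef
  refine (abs_le_of_sq_le_sq' ?_ (mul_nonneg hK0 h7)).2
  rw [e1] at h1
  rw [h5] at h4
  rw [mul_pow]
  exact (h1.trans h4).trans (mul_le_mul_of_nonneg_left h6 (sq_nonneg _))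

/-! ### Homogeneity, dual certificates and rounding. -/

theorem grad_smul {x : S.Vec} (hx : (S.Lam x).PosDef) {c : ℝ} (hc : 0 < c) :
    S.grad (c • x) = c⁻¹ • S.grad x := by
  ext u
  have hcx : (S.Lam (c • x)).PosDef := by rw [Lam_smul]; exact hx.smul hc
  rw [S.grad_apply hcx, Lam_smul, inv_smul_of_ne_zero hx.isUnit_det hc.ne', Pi.smul_apply,
    S.grad_apply hx, Matrix.smul_mul, Matrix.trace_smul, smul_neg]

theorem hess_smul {x : S.Vec} (hx : (S.Lam x).PosDef) {c : ℝ} (hc : 0 < c) :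
    S.hess (c • x) = (c⁻¹ * c⁻¹) • S.hess x := by
  ext u v
  have hcx : (S.Lam (c • x)).PosDef := by rw [Lam_smul]; exact hx.smul hc
  rw [S.hess_apply hcx, Lam_smul, inv_smul_of_ne_zero hx.isUnit_det hc.ne', Matrix.smul_apply,
    S.hess_apply hx]
  simp only [Matrix.smul_mul, Matrix.mul_smul, Matrix.trace_smul, smul_smul, smul_eq_mul]

theorem dualNorm_smul_left (hS : (interior S.cone).Nonempty) {x : S.Vec}
    (hx : (S.Lam x).PosDef) {c : ℝ} (hc : 0 < c) (t : S.Vec) :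
    S.dualNorm (c • x) t = S.dualNorm x (c • t) := by
  rw [dualNorm_smul, abs_of_pos hc, dualNorm, dualNorm, hess_smul hx hc,
    inv_smul_of_ne_zero (hess_posDef hS hx).isUnit_det (by positivity), Matrix.smul_mulVec,
    dotProduct_smul, mul_inv, inv_inv, smul_eq_mul, Real.sqrt_mul (by positivity),
    Real.sqrt_mul_self hc.le]

theorem inv_mulVec_mem_interior (hS : (interior S.cone).Nonempty) {x t : S.Vec}
    (hx : (S.Lam x).PosDef) (h : S.dualNorm x (-S.grad x - t) < 1) :
    (S.hess x)⁻¹ *ᵥ t ∈ interior S.dualCone := by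
  rw [S.mem_interior_dualCone_iff]
  refine posDef_of_localNorm_lt hS hx ?_
  rw [← localNorm_sub_inv_mulVec hS hx] at h
  rwa [← neg_sub, localNorm_eq, formNorm_neg]

/-- The positive semidefinite matrix Λ(x)⁻¹Λ(H(x)⁻¹t)Λ(x)⁻¹ represents t, hence is an explicit Gram
matrix for it. -/
theorem mem_cone_of_inv_mulVec_mem (hS : (interior S.cone).Nonempty) {x t : S.Vec}
    (hx : (S.Lam x).PosDef) (h : (S.hess x)⁻¹ *ᵥ t ∈ S.dualCone) : t ∈ S.cone := by
  have hM := (S.mem_dualCone_iff.1 h).mul_mul_conjTranspose_same (S.Lam x)⁻¹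
  rw [Matrix.conjTranspose_eq_transpose_of_trivial, inv_transpose_of_posDef hx] at hM
  obtain ⟨s, hs, hsx⟩ := S.exists_mem_cone_of_posSemidef hM
  have : t = s := funext fun u => by
    rw [← dotProduct_single_one t, ← dotProduct_single_one s, hsx,
      dotProduct_eq_trace_mul hS hx]
  rwa [this]

theorem mem_interior_cone (hS : (interior S.cone).Nonempty) {x t : S.Vec}
    (hx : (S.Lam x).PosDef) (h : S.dualNorm x (-S.grad x - t) < 1) : t ∈ interior S.cone := by
  have hc : Continuous fun t : S.Vec => (S.hess x)⁻¹ *ᵥ t := by fun_prop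
  exact mem_interior.2 ⟨_, fun t' ht' => mem_cone_of_inv_mulVec_mem hS hx (interior_subset ht'),
    isOpen_interior.preimage hc, inv_mulVec_mem_interior hS hx h⟩

theorem localNorm_rounding_le (hS : (interior S.cone).Nonempty) {xp xN : S.Vec}
    (hx : (S.Lam xp).PosDef) {N : ℕ} (h : S.IsRounding N xp xN) :
    S.localNorm xp (xN - xp) ≤ ‖CFC.sqrt (S.hess xp)‖ * (√(S.U : ℝ) * (1 / (2 * N))) := by
  have hQ := (hess_posDef hS hx).posSemidef
  set C := CFC.sqrt (S.hess xp)
  have hC : Cᵀ = C := by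
    simpa [Matrix.IsHermitian] using (CFC.sqrt_nonneg (S.hess xp)).posSemidef.isHermitian
  have hCC : C * C = S.hess xp := CFC.sqrt_mul_sqrt_self _ hQ.nonneg
  have e : S.localNorm xp (xN - xp) = ‖WithLp.toLp 2 (C *ᵥ (xN - xp))‖ := by
    rw [localNorm, EuclideanSpace.norm_eq, ← hCC, ← Matrix.mulVec_mulVec,
      Matrix.dotProduct_mulVec]
    nth_rewrite 1 [← hC]
    rw [Matrix.vecMul_transpose]
    simp [dotProduct, sq]
  rw [e]
  refine (Matrix.l2_opNorm_mulVec C (WithLp.toLp 2 (xN - xp))).trans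
    (mul_le_mul_of_nonneg_left ?_ (norm_nonneg _))
  rw [EuclideanSpace.norm_eq, ← Real.sqrt_sq (by positivity : 0 ≤ 1 / (2 * (N : ℝ))),
    ← Real.sqrt_mul (by positivity)]
  refine Real.sqrt_le_sqrt ?_
  calc ∑ i, ‖(WithLp.toLp 2 (xN - xp)) i‖ ^ 2 ≤ ∑ _i : Fin S.U, (1 / (2 * (N : ℝ))) ^ 2 :=
        Finset.sum_le_sum fun i _ => pow_le_pow_left₀ (norm_nonneg _) (h i).2 2
    _ = _ := by simp

theorem exists_isRounding {N : ℕ} (hN : 0 < N) (xp : S.Vec) : ∃ xN, S.IsRounding N xp xN := by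
  refine ⟨fun u => round (xp u * N) / N, fun u => ⟨⟨_, rfl⟩, ?_⟩⟩
  have hN' : (0 : ℝ) < N := Nat.cast_pos.2 hN
  have h := abs_sub_round (xp u * N)
  rw [abs_sub_comm] at h
  have e : (round (xp u * N) : ℝ) / N - xp u = (round (xp u * N) - xp u * N) / N := by
    field_simp
  rw [e, abs_div, abs_of_pos hN', div_le_div_iff₀ hN' (by positivity)]
  nlinarith

end

end Setup

/-! ### Existence of the simplest rational and of the largest root. -/

theorem exists_isSimplestRat {a b : ℝ} (hab : a < b) : ∃ c, IsSimplestRat a b c := by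
  classical
  have hex : ∃ d, ∃ c : ℚ, (c : ℝ) ∈ Set.Icc a b ∧ c.den = d := by
    obtain ⟨c, h1, h2⟩ := exists_rat_btwn hab
    exact ⟨_, c, ⟨h1.le, h2.le⟩, rfl⟩
  obtain ⟨c, hc, hd⟩ := Nat.find_spec hex
  exact ⟨c, hc, fun k hk => hd.trans_le (Nat.find_min' hex ⟨k, hk, rfl⟩)⟩

section Line

variable {ι : Type*} [Fintype ι] {Q : Matrix ι ι ℝ}

theorem continuous_formNorm : Continuous (formNorm Q) := by
  unfold formNorm
  fun_prop

variable [DecidableEq ι]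

theorem formNorm_sub_smul_le (hQ : Q.PosSemidef) (a e : ι → ℝ) (t t' : ℝ) :
    formNorm Q (a - t' • e) ≤ formNorm Q (a - t • e) + |t' - t| * formNorm Q e := by
  have h := formNorm_add_le hQ (a - t • e) ((t - t') • e)
  rw [formNorm_smul, abs_sub_comm] at h
  convert h using 2
  module

theorem formNorm_sub_smul_convex (hQ : Q.PosSemidef) (a e : ι → ℝ) (t t' θ : ℝ) (h0 : 0 ≤ θ)
    (h1 : θ ≤ 1) : formNorm Q (a - (t + θ * (t' - t)) • e)
      ≤ (1 - θ) * formNorm Q (a - t • e) + θ * formNorm Q (a - t' • e) := by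
  have h := formNorm_add_le hQ ((1 - θ) • (a - t • e)) (θ • (a - t' • e))
  rw [formNorm_smul, formNorm_smul, abs_of_nonneg h0, abs_of_nonneg (sub_nonneg.2 h1)] at h
  convert h using 2
  module

theorem exists_root_gt (hQ : Q.PosDef) (a : ι → ℝ) {e : ι → ℝ} (he : e ≠ 0) {c ρ : ℝ}
    (hc : formNorm Q (a - c • e) < ρ) : ∃ t, c < t ∧ formNorm Q (a - t • e) = ρ := by
  have he' : 0 < formNorm Q e := Real.sqrt_pos.2 (by simpa using hQ.dotProduct_mulVec_pos he)
  set φ : ℝ → ℝ := fun t => formNorm Q (a - t • e) with hφ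
  have hcont : Continuous φ := continuous_formNorm.comp (by fun_prop)
  have hφc : 0 ≤ φ c := formNorm_nonneg _ _
  -- Chosen so that the triangle inequality gives φ(b) ≥ (b - c)‖e‖ - φ(c) = ρ.
  set b := c + (ρ + φ c) / formNorm Q e with hb
  have hcb : c ≤ b := by
    have : 0 ≤ (ρ + φ c) / formNorm Q e := div_nonneg (by linarith [show φ c < ρ from hc]) he'.le
    linarith
  have hφb : ρ ≤ φ b := by
    have h := formNorm_add_le hQ.posSemidef (a - c • e) (-(a - b • e))
    rw [formNorm_neg, show a - c • e + -(a - b • e) = (b - c) • e by module, formNorm_smul,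
      abs_of_nonneg (sub_nonneg.2 hcb), show b - c = (ρ + φ c) / formNorm Q e by rw [hb]; ring,
      div_mul_cancel₀ _ he'.ne'] at h
    simp only [hφ] at *
    linarith
  obtain ⟨t, ht, hteq⟩ := intermediate_value_Icc hcb hcont.continuousOn ⟨hc.le, hφb⟩
  refine ⟨t, lt_of_le_of_ne ht.1 ?_, hteq⟩
  rintro rfl
  exact hc.ne hteq

theorem exists_isGreatest_root (hQ : Q.PosDef) (a : ι → ℝ) {e : ι → ℝ} (he : e ≠ 0) {c ρ : ℝ}
    (hc : formNorm Q (a - c • e) < ρ) :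
    ∃ t, IsGreatest {t : ℝ | formNorm Q (a - t • e) = ρ} t := by
  have he' : 0 < formNorm Q e := Real.sqrt_pos.2 (by simpa using hQ.dotProduct_mulVec_pos he)
  obtain ⟨t₀, -, ht₀⟩ := exists_root_gt hQ a he hc
  have hcont : Continuous fun t : ℝ => formNorm Q (a - t • e) :=
    continuous_formNorm.comp (by fun_prop)
  have hclosed : IsClosed {t : ℝ | formNorm Q (a - t • e) = ρ} :=
    isClosed_eq hcont continuous_const
  have hbdd : BddAbove {t : ℝ | formNorm Q (a - t • e) = ρ} := by
    refine ⟨(ρ + formNorm Q a) / formNorm Q e, fun t ht => ?_⟩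
    rw [le_div_iff₀ he']
    have h := formNorm_add_le hQ.posSemidef (-(a - t • e)) a
    rw [formNorm_neg, show -(a - t • e) + a = t • e by module, formNorm_smul,
      show formNorm Q (a - t • e) = ρ from ht] at h
    exact (mul_le_mul_of_nonneg_right (le_abs_self t) he'.le).trans h
  exact ⟨_, hclosed.csSup_mem ⟨t₀, ht₀⟩ hbdd, fun t ht => le_csSup hbdd ht⟩

end Line

/-! ### One pass through the loop. -/

/-- The bound guaranteed by the rounding denominator on the size of the rounding error. -/
def roundError (r rN : ℝ) : ℝ := (rN - r ^ 2 / (1 - 2 * r)) / (1 + rN)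

/-- The bound on the Newton decrement after a Newton step followed by rounding. -/
def roundedDecrement (r rN : ℝ) : ℝ :=
  roundError r rN + (1 + roundError r rN) * (r / (r + 1)) ^ 2

theorem roundedDecrement_lt {r rN : ℝ} (hr : 0 < r) (hr' : r ≤ 1 / 4)
    (hrN : r ^ 2 / (1 - 2 * r) < rN) (hrN' : rN < r / (1 + 2 * r)) :
    0 < rN ∧ 0 < roundError r rN ∧ roundError r rN < 1 ∧
      roundedDecrement r rN < r / (r + 1) := by
  rw [roundedDecrement]
  set δ := roundError r rN with hδ
  rw [roundError] at hδ
  set R := r ^ 2 / (1 - 2 * r) with hR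
  have hR1 : r ^ 2 ≤ R := by
    rw [hR, le_div_iff₀ (by linarith)]
    nlinarith [pow_pos hr 3]
  have hrN0 : 0 < rN := lt_of_le_of_lt (by positivity) (hR1.trans_lt hrN)
  have h0 : 0 < δ := hδ ▸ div_pos (by linarith) (by linarith)
  -- The bounds R ≥ r² and 1 + rN ≥ 1 remove rN; what remains is a rational inequality in r alone.
  have h1 : δ < r / (1 + 2 * r) - r ^ 2 := by
    rw [hδ]
    refine lt_of_le_of_lt (div_le_self (by linarith) (by linarith)) (by linarith)
  have h2 : (r / (1 + 2 * r) - r ^ 2) * (1 + (r / (r + 1)) ^ 2)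
      ≤ r / (r + 1) - (r / (r + 1)) ^ 2 := by
    have e : r / (r + 1) - (r / (r + 1)) ^ 2 - (r / (1 + 2 * r) - r ^ 2) * (1 + (r / (r + 1)) ^ 2)
        = r ^ 2 * (1 + 2 * r + 6 * r ^ 2 + 4 * r ^ 3) / ((1 + 2 * r) * (r + 1) ^ 2) := by
      field_simp
      ring
    have : 0 ≤ r / (r + 1) - (r / (r + 1)) ^ 2
        - (r / (1 + 2 * r) - r ^ 2) * (1 + (r / (r + 1)) ^ 2) := by
      rw [e]; positivity
    linarith
  have h3 : r / (1 + 2 * r) ≤ r := div_le_self hr.le (by linarith)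
  refine ⟨hrN0, h0, by nlinarith, ?_⟩
  have h4 : δ * (1 + (r / (r + 1)) ^ 2) < (r / (1 + 2 * r) - r ^ 2) * (1 + (r / (r + 1)) ^ 2) :=
    mul_lt_mul_of_pos_right h1 (by positivity)
  linarith

namespace Setup

variable {n m : ℕ} {S : Setup n m}

theorem newton_posDef (hS : (interior S.cone).Nonempty) {r : ℝ} (hr : 0 < r)
    {x t : S.Vec} (hx : (S.Lam x).PosDef) (hxt : S.dualNorm x (-S.grad x - t) ≤ r / (r + 1)) :
    (S.Lam ((2 : ℝ) • x - (S.hess x)⁻¹ *ᵥ t)).PosDef := by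
  have hρ : r / (r + 1) < 1 := by rw [div_lt_one (by linarith)]; linarith
  refine posDef_of_localNorm_lt hS hx ?_
  rw [show (2 : ℝ) • x - (S.hess x)⁻¹ *ᵥ t - x = x - (S.hess x)⁻¹ *ᵥ t by module,
    localNorm_sub_inv_mulVec hS hx]
  exact hxt.trans_lt hρ

/-- One Newton step followed by rounding. -/
theorem newton_round (hS : (interior S.cone).Nonempty) {r rN : ℝ} (hr : 0 < r) (hr' : r ≤ 1 / 4)
    (hrN : r ^ 2 / (1 - 2 * r) < rN) (hrN' : rN < r / (1 + 2 * r)) {x t xp xN : S.Vec}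
    (hx : (S.Lam x).PosDef) (hxt : S.dualNorm x (-S.grad x - t) ≤ r / (r + 1))
    (hxp : xp = (2 : ℝ) • x - (S.hess x)⁻¹ *ᵥ t)
    (hxN : S.IsRounding (S.roundDenom r rN xp) xp xN) :
    (S.Lam xN).PosDef ∧ S.dualNorm xN (-S.grad xN - t) ≤ roundedDecrement r rN := by
  obtain ⟨h0, hδ0, hδ1, -⟩ := roundedDecrement_lt hr hr' hrN hrN'
  have hp : (S.Lam xp).PosDef := hxp ▸ newton_posDef hS hr hx hxt
  have hδ : S.localNorm xp (xN - xp) ≤ roundError r rN := by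
    refine (localNorm_rounding_le hS hp hxN).trans ?_
    set N := S.roundDenom r rN xp with hN
    -- For N = 0 the convention 1/0 = 0 makes the rounding bound zero.
    rcases Nat.eq_zero_or_pos N with h | h
    · simpa [h] using hδ0.le
    · have h1 : √(S.U : ℝ) / 2 * ((1 + rN) / (rN - r ^ 2 / (1 - 2 * r)))
          * ‖CFC.sqrt (S.hess xp)‖ ≤ N := Nat.le_ceil _
      have h2 : roundError r rN * ((1 + rN) / (rN - r ^ 2 / (1 - 2 * r))) = 1 := by
        rw [roundError, div_mul_div_comm, mul_comm, div_self]
        exact mul_ne_zero (by linarith) (by linarith)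
      have h3 := mul_le_mul_of_nonneg_left h1 hδ0.le
      have hN' : (0 : ℝ) < N := Nat.cast_pos.2 h
      have h4 : ‖CFC.sqrt (S.hess xp)‖ * √(S.U : ℝ) / 2 ≤ roundError r rN * N := by
        refine le_trans (le_of_eq ?_) h3
        linear_combination (-‖CFC.sqrt (S.hess xp)‖ * √(S.U : ℝ) / 2) * h2
      have e : ‖CFC.sqrt (S.hess xp)‖ * (√(S.U : ℝ) * (1 / (2 * N)))
          = ‖CFC.sqrt (S.hess xp)‖ * √(S.U : ℝ) / 2 / N := by field_simp
      rw [e, div_le_iff₀ hN']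
      exact h4
  have hNP : (S.Lam xN).PosDef := posDef_of_localNorm_lt hS hp (hδ.trans_lt hδ1)
  refine ⟨hNP, ?_⟩
  have h1 := (dualNorm_newton_le hS hx hp hxp).trans
    (pow_le_pow_left₀ (S.dualNorm_nonneg _ _) hxt 2)
  -- At xN the residual splits into the change of gradient caused by rounding and the old residual,
  -- whose norm grows by at most the factor 1 + δ.
  have h2 := dualNorm_le_mul_dualNorm hS hp hNP (-S.grad xp - t)
  have h3 := dualNorm_grad_sub_grad_le hS hp hNP
  have h4 := dualNorm_add_le hS hNP (-(S.grad xN - S.grad xp)) (-S.grad xp - t)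
  rw [dualNorm_neg, show -(S.grad xN - S.grad xp) + (-S.grad xp - t) = -S.grad xN - t by abel]
    at h4
  have h5 := mul_le_mul (add_le_add_right hδ 1) h1 (S.dualNorm_nonneg _ _) (by linarith)
  rw [roundedDecrement]
  linarith

theorem decrement_eq (x s e : S.Vec) (t : ℝ) :
    S.dualNorm x (-S.grad x - (s + t • e)) = formNorm (S.hess x)⁻¹ (-S.grad x - s - t • e) := by
  rw [dualNorm_eq, sub_sub]

theorem loopStep_spec (hS : (interior S.cone).Nonempty) {r rN : ℝ} (hr : 0 < r) (hr' : r ≤ 1 / 4)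
    (hrN : r ^ 2 / (1 - 2 * r) < rN) (hrN' : rN < r / (1 + 2 * r)) {e s : S.Vec} (he : e ≠ 0)
    {a b : S.State} (ha : (S.Lam a.x).PosDef)
    (hat : S.dualNorm a.x (-S.grad a.x - (s + (a.c : ℝ) • e)) ≤ r / (r + 1))
    (hab : S.LoopStep e s r rN a b) :
    (S.Lam b.x).PosDef ∧
    S.dualNorm b.x (-S.grad b.x - (s + (a.c : ℝ) • e)) ≤ r / (r + 1) ∧
    S.dualNorm b.x (-S.grad b.x - (s + (b.c : ℝ) • e))
      ≤ r / (r + 1) - (r / (r + 1) - roundedDecrement r rN) / 3 ∧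
    (a.c : ℝ) < b.c ∧
    (r / (r + 1) - roundedDecrement r rN) ≤ 2 * (b.c - a.c) * S.dualNorm b.x e := by
  obtain ⟨xp, xN, cp, hxp, hxN, hcp, ⟨hc, -⟩, hb⟩ := hab
  obtain ⟨hP, hd⟩ := newton_round hS hr hr' hrN hrN' ha hat hxp hxN
  rw [hb]
  have hlt := (roundedDecrement_lt hr hr' hrN hrN').2.2.2
  simp only [localNorm_sub_inv_mulVec hS hP, decrement_eq] at hcp
  rw [decrement_eq] at hd
  have hQ := (hess_posDef hS hP).inv
  simp only [decrement_eq, dualNorm_eq _ _ e]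
  set c : ℝ := (a.c : ℝ)
  set c' : ℝ := (b.c : ℝ)
  set v := -S.grad xN - s
  set ρ := r / (r + 1)
  -- The decrement at c is strictly below ρ, so some root lies to the right of c, and the largest
  -- root does too.
  obtain ⟨t₁, ht₁, ht₁'⟩ := exists_root_gt hQ v he (hd.trans_lt hlt)
  have hccp : c < cp := ht₁.trans_le (hcp.2 ht₁')
  have hroot : formNorm (S.hess xN)⁻¹ (v - cp • e) = ρ := hcp.1
  refine ⟨hP, hd.trans hlt.le, ?_, by linarith [hc.1], ?_⟩
  · set θ := (c' - c) / (cp - c) with hθ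
    have hpos : 0 < cp - c := sub_pos.2 hccp
    have h1 : 1 / 2 ≤ θ := by rw [hθ, le_div_iff₀ hpos]; linarith [hc.1]
    have h2 : θ ≤ 2 / 3 := by rw [hθ, div_le_iff₀ hpos]; linarith [hc.2]
    have e1 : c' = c + θ * (cp - c) := by rw [hθ, div_mul_cancel₀ _ hpos.ne']; ring
    -- The decrement is convex in c, at most `roundedDecrement` at c and equal to ρ at c₊; θ ≤ 2/3
    -- leaves a third of the gap.
    have h3 := formNorm_sub_smul_convex hQ.posSemidef v e c cp θ (by linarith) (by linarith)
    rw [← e1, hroot] at h3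
    nlinarith
  · have h3 := formNorm_sub_smul_le hQ.posSemidef v e c cp
    rw [hroot, abs_of_pos (sub_pos.2 hccp)] at h3
    have h4 : cp - c ≤ 2 * (c' - c) := by linarith [hc.1]
    have := mul_le_mul_of_nonneg_right h4 (formNorm_nonneg (S.hess xN)⁻¹ e)
    linarith

theorem exists_loopStep (hS : (interior S.cone).Nonempty) {r rN : ℝ} (hr : 0 < r)
    (hr' : r ≤ 1 / 4) (hrN : r ^ 2 / (1 - 2 * r) < rN) (hrN' : rN < r / (1 + 2 * r))
    {e s : S.Vec} (he : e ≠ 0) {a : S.State} (ha : (S.Lam a.x).PosDef)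
    (hat : S.dualNorm a.x (-S.grad a.x - (s + (a.c : ℝ) • e)) ≤ r / (r + 1)) :
    ∃ b, S.LoopStep e s r rN a b := by
  obtain ⟨hrN0, -, -, hlt⟩ := roundedDecrement_lt hr hr' hrN hrN'
  set xp := (2 : ℝ) • a.x - (S.hess a.x)⁻¹ *ᵥ (s + (a.c : ℝ) • e) with hxp
  have hp : (S.Lam xp).PosDef := newton_posDef hS hr ha hat
  have hU : 0 < S.U := by
    rcases Nat.eq_zero_or_pos S.U with h | h
    · have : IsEmpty (Fin S.U) := by rw [h]; infer_instance
      exact absurd (Subsingleton.elim _ _) he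
    · exact h
  have hH := hess_posDef hS hp
  have hnorm : 0 < ‖CFC.sqrt (S.hess xp)‖ := by
    refine norm_pos_iff.2 fun h => ?_
    have h1 := CFC.sqrt_mul_sqrt_self (S.hess xp) hH.posSemidef.nonneg
    rw [h, Matrix.mul_zero] at h1
    have h2 := hH.dotProduct_mulVec_pos he
    rw [← h1] at h2
    simp at h2
  have hN : 0 < S.roundDenom r rN xp := by
    refine Nat.ceil_pos.2 ?_
    have : 0 < rN - r ^ 2 / (1 - 2 * r) := by linarith
    have : (0 : ℝ) < S.U := Nat.cast_pos.2 hU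
    positivity
  obtain ⟨xN, hxN⟩ := exists_isRounding hN xp
  obtain ⟨hP, hd⟩ := newton_round hS hr hr' hrN hrN' ha hat hxp hxN
  rw [decrement_eq] at hd
  have hQ := (hess_posDef hS hP).inv
  obtain ⟨cp, hcp⟩ := exists_isGreatest_root hQ _ he (hd.trans_lt hlt)
  obtain ⟨t₁, ht₁, ht₁'⟩ := exists_root_gt hQ _ he (hd.trans_lt hlt)
  have hccp : (a.c : ℝ) < cp := ht₁.trans_le (hcp.2 ht₁')
  obtain ⟨c', hc'⟩ := exists_isSimplestRat
    (a := a.c + 1 / 2 * (cp - a.c)) (b := a.c + 2 / 3 * (cp - a.c)) (by linarith)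
  refine ⟨⟨xN, c'⟩, xp, xN, cp, hxp, hxN, ?_, hc', rfl⟩
  simp only [localNorm_sub_inv_mulVec hS hP, decrement_eq]
  exact hcp

/-! ### The invariant, the growth of c and the decay of ‖s‖*. -/

/-- The invariant of the loop. -/
def Inv (e s : S.Vec) (r : ℝ) (a : S.State) : Prop :=
  (S.Lam a.x).PosDef ∧ (0 : ℝ) ≤ a.c ∧
    S.dualNorm a.x (-S.grad a.x - (s + (a.c : ℝ) • e)) ≤ r / (r + 1)

theorem Inv.step (hS : (interior S.cone).Nonempty) {r rN : ℝ} (hr : 0 < r) (hr' : r ≤ 1 / 4)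
    (hrN : r ^ 2 / (1 - 2 * r) < rN) (hrN' : rN < r / (1 + 2 * r)) {e s : S.Vec} (he : e ≠ 0)
    {a b : S.State} (ha : Inv e s r a) (hab : S.LoopStep e s r rN a b) : Inv e s r b := by
  obtain ⟨h1, -, h2, h3, -⟩ := loopStep_spec hS hr hr' hrN hrN' he ha.1 ha.2.2 hab
  have hlt := (roundedDecrement_lt hr hr' hrN hrN').2.2.2
  exact ⟨h1, ha.2.1.trans h3.le, by linarith⟩

theorem inv_start {e x₀ : S.Vec} (hx₀ : (S.Lam x₀).PosDef) {r : ℝ} (hr : 0 < r) :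
    Inv e (-S.grad x₀) r (S.start x₀) := by
  refine ⟨hx₀, by simp [start], ?_⟩
  have : S.dualNorm x₀ 0 = 0 := by simp [dualNorm]
  simp only [start, Rat.cast_zero, zero_smul, add_zero, sub_self, this]
  positivity

theorem Reachable.inv (hS : (interior S.cone).Nonempty) {r rN : ℝ} (hr : 0 < r) (hr' : r ≤ 1 / 4)
    (hrN : r ^ 2 / (1 - 2 * r) < rN) (hrN' : rN < r / (1 + 2 * r)) {e x₀ : S.Vec} (he : e ≠ 0)
    (hx₀ : (S.Lam x₀).PosDef) {a : S.State} (ha : S.Reachable e r rN x₀ a) :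
    Inv e (-S.grad x₀) r a := by
  induction ha with
  | refl => exact inv_start hx₀ hr
  | tail _ hbc ih => exact ih.step hS hr hr' hrN hrN' he hbc

theorem IsRun.reachable {e x₀ : S.Vec} {r rN : ℝ} {σ : ℕ → S.State} (h : S.IsRun e r rN x₀ σ)
    (k : ℕ) : S.Reachable e r rN x₀ (σ k) := by
  induction k with
  | zero => rw [h.1]; exact .refl
  | succ k ih => exact ih.tail (h.2 k)

/-- A bound on `t ⬝ᵥ x` for all `x` with `‖-g(x) - t‖*_x ≤ 1`. -/
def pairingBound (S : Setup n m) : ℝ :=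
  Fintype.card (Σ i, Fin (S.L i)) + √(Fintype.card (Σ i, Fin (S.L i)))

theorem dotProduct_le_pairingBound (hS : (interior S.cone).Nonempty) {r : ℝ} (hr : 0 < r)
    {x t : S.Vec} (hx : (S.Lam x).PosDef) (h : S.dualNorm x (-S.grad x - t) ≤ r / (r + 1)) :
    t ⬝ᵥ x ≤ pairingBound S := by
  have hρ : r / (r + 1) ≤ 1 := by rw [div_le_one (by linarith)]; linarith
  refine (dotProduct_self_le hS hx t).trans ?_
  rw [pairingBound, ← localNorm_self hS hx, Real.sqrt_sq (S.localNorm_nonneg _ _)]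
  have := mul_le_mul_of_nonneg_right (h.trans hρ) (S.localNorm_nonneg x x)
  linarith

theorem dotProduct_nonneg {x t : S.Vec} (hx : (S.Lam x).PosDef) (ht : t ∈ S.cone) :
    0 ≤ t ⬝ᵥ x := S.mem_dualCone_iff.2 hx.posSemidef t ht

/-- Every pass through the loop increases `c` by at least a fixed amount. -/
theorem exists_increment (hS : (interior S.cone).Nonempty) {r rN : ℝ} (hr : 0 < r)
    (hr' : r ≤ 1 / 4) (hrN : r ^ 2 / (1 - 2 * r) < rN) (hrN' : rN < r / (1 + 2 * r))
    {e x₀ : S.Vec} (he : e ≠ 0) (hec : e ∈ S.cone) (hx₀ : (S.Lam x₀).PosDef) :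
    ∃ η > 0, ∀ a b : S.State, Inv e (-S.grad x₀) r a →
      S.LoopStep e (-S.grad x₀) r rN a b → (a.c : ℝ) + η ≤ b.c := by
  have hlt := (roundedDecrement_lt hr hr' hrN hrN').2.2.2
  set B := S.dualNorm x₀ e * pairingBound S with hB
  have hB0 : 0 ≤ B := mul_nonneg (S.dualNorm_nonneg _ _) (by unfold pairingBound; positivity)
  refine ⟨(r / (r + 1) - roundedDecrement r rN) / (2 * (B + 1)),
    div_pos (sub_pos.2 hlt) (by linarith), fun a b ha hab => ?_⟩
  obtain ⟨h1, h2, -, h3, h4⟩ := loopStep_spec hS hr hr' hrN hrN' he ha.1 ha.2.2 hab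
  -- The new x paired with the old c: this decrement bound holds before c is replaced. As c ≥ 0 and
  -- e ∈ Σ, dropping c⟨e, x⟩ bounds ⟨s, x⟩.
  have h5 := dotProduct_le_pairingBound hS hr h1 h2
  rw [add_dotProduct, smul_dotProduct, smul_eq_mul] at h5
  have h6 := mul_nonneg ha.2.1 (dotProduct_nonneg h1 hec)
  have h7 : S.dualNorm b.x e ≤ B + 1 := by
    have h8 := mul_le_mul_of_nonneg_left (by linarith : -S.grad x₀ ⬝ᵥ b.x ≤ pairingBound S)
      (S.dualNorm_nonneg x₀ e)
    linarith [dualNorm_le_mul_dotProduct hS h1 hx₀ e]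
  have h9 : (r / (r + 1) - roundedDecrement r rN) / (2 * (B + 1)) ≤ b.c - a.c := by
    rw [div_le_iff₀ (by linarith)]
    have := mul_le_mul_of_nonneg_left h7 (by linarith : 0 ≤ 2 * ((b.c : ℝ) - a.c))
    linarith
  linarith

theorem exists_smul_sub_mem_cone {e s : S.Vec} (he : e ∈ interior S.cone) :
    ∃ κ : ℝ, 0 < κ ∧ e - κ • s ∈ S.cone := by
  have ht : Tendsto (fun ε : ℝ => e - ε • s) (𝓝[>] 0) (𝓝 e) := by
    have : Continuous fun ε : ℝ => e - ε • s := by fun_prop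
    simpa using (this.tendsto 0).mono_left nhdsWithin_le_nhds
  obtain ⟨ε, h1, h2⟩ := ((ht.eventually (mem_interior_iff_mem_nhds.1 he)).and
    self_mem_nhdsWithin).exists
  exact ⟨ε, h2, h1⟩

/-- From e - κs ∈ Σ follows cκ⟨s, x⟩ ≤ c⟨e, x⟩ ≤ ν + √ν, and ‖s‖*_x ≤ ⟨s, x⟩. -/
theorem exists_dualNorm_le_div {r : ℝ} (hr : 0 < r) {e x₀ : S.Vec} (he : e ∈ interior S.cone)
    (hx₀ : (S.Lam x₀).PosDef) :
    ∃ B : ℝ, 0 ≤ B ∧ ∀ a : S.State, Inv e (-S.grad x₀) r a → (0 : ℝ) < a.c →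
      S.dualNorm a.x (-S.grad x₀) ≤ B / a.c := by
  have hS : (interior S.cone).Nonempty := ⟨e, he⟩
  obtain ⟨κ, hκ, hmem⟩ := exists_smul_sub_mem_cone (s := -S.grad x₀) he
  refine ⟨pairingBound S / κ, div_nonneg (by unfold pairingBound; positivity) hκ.le,
    fun a ha hc => ?_⟩
  have h1 := dualNorm_neg_grad_le hS ha.1 hx₀
  have h2 := dotProduct_nonneg ha.1 hmem
  have h3 := dotProduct_le_pairingBound hS hr ha.1 ha.2.2
  rw [add_dotProduct, smul_dotProduct, smul_eq_mul] at h3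
  rw [sub_dotProduct, smul_dotProduct, smul_eq_mul] at h2
  have h4 : 0 ≤ -S.grad x₀ ⬝ᵥ a.x := (S.dualNorm_nonneg _ _).trans h1
  rw [div_div, le_div_iff₀ (mul_pos hκ hc)]
  have h5 := mul_le_mul_of_nonneg_left (sub_nonneg.1 h2) hc.le
  have h6 := mul_le_mul_of_nonneg_right h1 (mul_pos hκ hc).le
  linarith

theorem stops_iff (hS : (interior S.cone).Nonempty) {e : S.Vec} {r : ℝ} {a : S.State}
    (ha : (S.Lam a.x).PosDef) (hc : (0 : ℝ) < a.c) :
    S.Stops e r a ↔ S.dualNorm a.x (-S.grad a.x - (a.c : ℝ) • e) ≤ r / (r + 1) := by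
  rw [Stops, dualNorm_smul_left hS ha hc, grad_smul ha hc, smul_sub, smul_neg, smul_smul,
    mul_inv_cancel₀ hc.ne', one_smul]

end Setup

end WSOS

end

/-! ### Certification, convergence and termination. -/

theorem mainTheorem12 {n m : ℕ} (S : WSOS.Setup n m)
    (e : S.Vec) (he : S.toPoly e = 1) (he_int : e ∈ interior S.cone)
    (r rN : ℝ) (hr : 0 < r) (hr' : r ≤ 1 / 4)
    (hrN : r ^ 2 / (1 - 2 * r) < rN) (hrN' : rN < r / (1 + 2 * r))
    (x₀ : S.Vec) (hx₀ : x₀ ∈ interior S.dualCone) :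
    -- the iterates are certificates, and the loop can always be executed once more
    (∀ a : S.State, S.Reachable e r rN x₀ a →
      a.x ∈ interior S.dualCone ∧
      -S.grad x₀ + (a.c : ℝ) • e ∈ interior S.cone ∧
      S.IsDualCertificate a.x (-S.grad x₀ + (a.c : ℝ) • e) ∧
      ∃ b : S.State, S.LoopStep e (-S.grad x₀) r rN a b) ∧
    -- the dual local norm of `s` tends to zero as `c` grows
    (∀ ε : ℝ, 0 < ε → ∃ C : ℝ, ∀ a : S.State, S.Reachable e r rN x₀ a →
      C ≤ (a.c : ℝ) → S.dualNorm a.x (-S.grad x₀) < ε) ∧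
    -- and it does so, with `c` tending to infinity, as the loop is repeated
    (∀ σ : ℕ → S.State, S.IsRun e r rN x₀ σ →
      Tendsto (fun k => ((σ k).c : ℝ)) atTop atTop ∧
      Tendsto (fun k => S.dualNorm (σ k).x (-S.grad x₀)) atTop (𝓝 0)) ∧
    -- the stopping criterion is met after finitely many passes, with a valid output
    (∀ σ : ℕ → S.State, S.IsRun e r rN x₀ σ →
      ∃ K : ℕ, IsLeast {k : ℕ | 1 ≤ k ∧ S.Stops e r (σ k)} K ∧
        ((σ K).c : ℝ) • (σ K).x ∈ interior S.dualCone ∧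
        S.dualNorm (((σ K).c : ℝ) • (σ K).x)
          (-S.grad (((σ K).c : ℝ) • (σ K).x) - e) ≤ r / (r + 1)) := by
  have hS : (interior S.cone).Nonempty := ⟨e, he_int⟩
  have hx₀' := S.mem_interior_dualCone_iff.1 hx₀
  have hec : e ∈ S.cone := interior_subset he_int
  have he0 : e ≠ 0 := by
    rintro rfl
    simp [WSOS.Setup.toPoly] at he
  have hρ : r / (r + 1) < 1 := by rw [div_lt_one (by linarith)]; linarith
  have hlt := (WSOS.roundedDecrement_lt hr hr' hrN hrN').2.2.2
  have hinv : ∀ a, S.Reachable e r rN x₀ a → WSOS.Setup.Inv e (-S.grad x₀) r a := fun a ha =>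
    ha.inv hS hr hr' hrN hrN' he0 hx₀'
  have hsmall : ∀ ε : ℝ, 0 < ε → ∃ C : ℝ, ∀ a : S.State, S.Reachable e r rN x₀ a →
      C ≤ (a.c : ℝ) → S.dualNorm a.x (-S.grad x₀) < ε := by
    obtain ⟨B, hB, h⟩ := WSOS.Setup.exists_dualNorm_le_div hr he_int hx₀'
    refine fun ε hε => ⟨B / ε + 1, fun a ha hC => ?_⟩
    have hc : (0 : ℝ) < a.c := by linarith [div_nonneg hB hε.le]
    refine (h a (hinv a ha) hc).trans_lt ?_
    rw [div_lt_iff₀ hc, mul_comm, ← div_lt_iff₀ hε]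
    linarith
  have hlim : ∀ σ : ℕ → S.State, S.IsRun e r rN x₀ σ →
      Tendsto (fun k => ((σ k).c : ℝ)) atTop atTop ∧
      Tendsto (fun k => S.dualNorm (σ k).x (-S.grad x₀)) atTop (𝓝 0) := by
    intro σ hσ
    obtain ⟨η, hη, h⟩ := WSOS.Setup.exists_increment hS hr hr' hrN hrN' he0 hec hx₀'
    have hc : ∀ k : ℕ, (k : ℝ) * η ≤ (σ k).c := by
      intro k
      induction k with
      | zero => simpa using (hinv _ (hσ.reachable 0)).2.1
      | succ k ih =>
        have := h _ _ (hinv _ (hσ.reachable k)) (hσ.2 k)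
        push_cast
        linarith
    have htop : Tendsto (fun k => ((σ k).c : ℝ)) atTop atTop :=
      tendsto_atTop_mono hc (tendsto_natCast_atTop_atTop.atTop_mul_const hη)
    refine ⟨htop, Metric.tendsto_atTop'.2 fun ε hε => ?_⟩
    obtain ⟨C, hC⟩ := hsmall ε hε
    obtain ⟨N, hN⟩ := eventually_atTop.1 (htop.eventually_ge_atTop C)
    refine ⟨N, fun k hk => ?_⟩
    rw [Real.dist_0_eq_abs, abs_of_nonneg (S.dualNorm_nonneg _ _)]
    exact hC _ (hσ.reachable k) (hN k hk.le)
  refine ⟨fun a ha => ?_, hsmall, hlim, fun σ hσ => ?_⟩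
  · obtain ⟨h1, -, h3⟩ := hinv a ha
    have hx := S.mem_interior_dualCone_iff.2 h1
    have ht := WSOS.Setup.mem_interior_cone hS h1 (h3.trans_lt hρ)
    exact ⟨hx, ht, ⟨interior_subset ht, hx,
      interior_subset (WSOS.Setup.inv_mulVec_mem_interior hS h1 (h3.trans_lt hρ))⟩,
      WSOS.Setup.exists_loopStep hS hr hr' hrN hrN' he0 h1 h3⟩
  · classical
    have hspec := fun k => WSOS.Setup.loopStep_spec hS hr hr' hrN hrN' he0
      (hinv _ (hσ.reachable k)).1 (hinv _ (hσ.reachable k)).2.2 (hσ.2 k)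
    have hpos : ∀ k, 1 ≤ k → (0 : ℝ) < (σ k).c := fun k hk => by
      obtain ⟨j, rfl⟩ := Nat.exists_eq_add_of_le' hk
      exact (hinv _ (hσ.reachable j)).2.1.trans_lt (hspec j).2.2.2.1
    have hex : ∃ k, 1 ≤ k ∧ S.Stops e r (σ k) := by
      -- The shift to k + 1 selects a state produced by a pass: only there is the decrement known to
      -- be a third of the gap below ρ, and c to be positive.
      obtain ⟨k, hk⟩ := ((hlim σ hσ).2.comp (tendsto_add_atTop_nat 1) |>.eventually_lt_const
        (by linarith : 0 < (r / (r + 1) - WSOS.roundedDecrement r rN) / 3)).exists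
      refine ⟨k + 1, by omega, ?_⟩
      have hP := (hspec k).1
      rw [WSOS.Setup.stops_iff hS hP (hpos _ (by omega))]
      have h := WSOS.Setup.dualNorm_add_le hS hP
        (-S.grad (σ (k + 1)).x - (-S.grad x₀ + ((σ (k + 1)).c : ℝ) • e)) (-S.grad x₀)
      rw [show -S.grad (σ (k + 1)).x - (-S.grad x₀ + ((σ (k + 1)).c : ℝ) • e) + -S.grad x₀
        = -S.grad (σ (k + 1)).x - ((σ (k + 1)).c : ℝ) • e by abel] at h
      have h2 := (hspec k).2.2.1
      simp only [Function.comp_apply] at hk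
      linarith
    have hK := Nat.find_spec hex
    refine ⟨Nat.find hex, ⟨hK, fun k hk => Nat.find_min' hex hk⟩, ?_, hK.2⟩
    rw [S.mem_interior_dualCone_iff, WSOS.Setup.Lam_smul]
    exact (hinv _ (hσ.reachable _)).1.smul (hpos _ hK.1)
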